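/- **Setting.** For $k\in\mathbb N$ let $A_k\in\mathbb R^{M_k\times N_k}$ be random sensing matrices on a common probability space, with $M_k\le N_k$, $N_k\to\infty$ and $M_k/N_k\to\delta\in(0,1]$. Each $A_k$ is right-orthogonally invariant: it has a singular-value decomposition $A_k=USV^{\mathrm T}$ with $V$ Haar-distributed on the orthogonal group and independent of $US$. Suppose that, almost surely, the empirical eigenvalue distribution of $A_k^{\mathrm T}A_k$ converges weakly to a deterministic probability measure $\nu$, and that for every $j$ the limit $\mu_j=\lim_{k\to\infty} N_k^{-1}\operatorname{Tr}\{(A_k^{\mathrm T}A_k)^j\}$ exists almost surely, is finite and deterministic. Let $\eta(z)=\int\frac{\nu(d\lambda)}{1+z\lambda}$ for $z\ge0$, and define the R-transform $R$ of $\nu$ by $\eta(z)=\dfrac{1}{1+zR(-z\eta(z))}$ for $z>0$, with $R(0)=\lim_{u\uparrow0}R(u)$. Let $x_1$ be a real random variable (the signal) and, for $s\ge0$, let $I(s)$ be the mutual information in nats between $x_1$ and $\sqrt s\,x_1+z_1$, where $z_1\sim\mathcal N(0,1)$ is independent of $x_1$. For $\sigma^2>0$, $E\in[0,1]$ and $s\ge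 0$ the replica-symmetric potential is $$f_{\mathrm{RS}}(E,s)=I(s)+\frac12\int_0^{E/\sigma^2}R(-z)\,dz-\frac{sE}{2}.$$ An *optimizer* $(E_{\mathrm{opt}},s_{\mathrm{opt}})\in[0,1]\times[0,\infty)$ of the problem $\inf_{s\ge0}\sup_{E\in[0,1]}f_{\mathrm{RS}}(E,s)$ is a pair such that $s_{\mathrm{opt}}$ attains the outer infimum and $E_{\mathrm{opt}}$ attains the inner supremum at $s=s_{\mathrm{opt}}$. The variable $x_1$ has *Rényi information dimension* $d_{\mathrm I}$ if the Shannon entropy of $\lfloor nx_1\rfloor/n$, divided by $\log n$, tends to $d_{\mathrm I}$ as $n\to\infty$. **Statement.** Assume that * $\mu_1>0$ and $\mu_2>\mu_1^2$; * $\operatorname{rank}(A_k)/N_k\to\delta$ almost surely, and the asymptotic eigenvalue distribution has the corresponding atom at zero, $\nu(\{0\})=1-\delta$ (no positive fraction of the nonzero eigenvalues collapses to zero); * $\delta<1$, or $\delta=1$ and the asymptotic mean inverse eigenvalue diverges: $\int\lambda^{-1}\,\nu(d\lambda)=\infty$; * $\mathbb E[x_1^2]=1$ and $x_1$ has Rényi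 information dimension $d_{\mathrm I}$. Then for every $\sigma^2>0$ an optimizer exists, and: 1. If $\delta\ne d_{\mathrm I}$, then for every choice of an optimizer $(E_{\mathrm{opt}},s_{\mathrm{opt}})$ for each $\sigma^2>0$, one has $E_{\mathrm{opt}}\to0$ and $s_{\mathrm{opt}}\to\infty$ as $\sigma^2\downarrow0$ if and only if $\delta>d_{\mathrm I}$. 2. If $\delta>d_{\mathrm I}$, then the optimizer is unique in the limit $\sigma^2\downarrow0$: the point $(0,\infty)$ is the one and only limit point in $[0,1]\times[0,\infty]$ of optimizers as $\sigma^2\downarrow0$. -/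

import Mathlib

open MeasureTheory ProbabilityTheory Filter Topology

namespace CompressedSensing

noncomputable section

/-! ### Sensing matrices -/

/-- Matrices carry the product (Borel) sigma-algebra of their entries. -/
instance matrixMeasurableSpace (m n : ℕ) : MeasurableSpace (Matrix (Fin m) (Fin n) ℝ) :=
  inferInstanceAs (MeasurableSpace (Fin m → Fin n → ℝ))

/-- A random `m × n` matrix `A` is right-orthogonally invariant: it has a singular-value
decomposition `A = U S Vᵀ` in which `V` is Haar-distributed on the orthogonal group `O_n` (its law
is a probability measure on `O_n` that is invariant under left multiplication) and independent of
`U S`. -/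
def IsRightOrthogonallyInvariant {Ω : Type*} [MeasurableSpace Ω] (P : Measure Ω) {m n : ℕ}
    (A : Ω → Matrix (Fin m) (Fin n) ℝ) : Prop :=
  ∃ (U : Ω → Matrix (Fin m) (Fin m) ℝ) (S : Ω → Matrix (Fin m) (Fin n) ℝ)
    (V : Ω → Matrix (Fin n) (Fin n) ℝ),
    Measurable U ∧ Measurable S ∧ Measurable V ∧
    (∀ ω, U ω ∈ Matrix.orthogonalGroup (Fin m) ℝ) ∧
    (∀ ω, V ω ∈ Matrix.orthogonalGroup (Fin n) ℝ) ∧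
    (∀ ω i j, 0 ≤ S ω i j ∧ ((i : ℕ) ≠ (j : ℕ) → S ω i j = 0)) ∧
    (∀ᵐ ω ∂P, A ω = U ω * S ω * (V ω).transpose) ∧
    (∀ O ∈ Matrix.orthogonalGroup (Fin n) ℝ,
      Measure.map (fun ω => O * V ω) P = Measure.map V P) ∧
    IndepFun V (fun ω => U ω * S ω) P

theorem isHermitian_gram {m n : ℕ} (A : Matrix (Fin m) (Fin n) ℝ) :
    (A.transpose * A).IsHermitian := by
  simpa [Matrix.conjTranspose_eq_transpose_of_trivial] using
    Matrix.isHermitian_conjTranspose_mul_self A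

/-- The integral of `f` against the empirical eigenvalue distribution of `Aᵀ A`, that is,
`n⁻¹ ∑ i, f (λ_i)` over the `n` eigenvalues of `Aᵀ A` counted with multiplicity. -/
def empiricalSpectralMean {m n : ℕ} (A : Matrix (Fin m) (Fin n) ℝ) (f : ℝ → ℝ) : ℝ :=
  (∑ i, f ((isHermitian_gram A).eigenvalues i)) / n

/-- `ν` is the asymptotic eigenvalue distribution of `Aᵀ A`: almost surely, the empirical
eigenvalue distributions converge weakly to the deterministic measure `ν`. -/
def IsAsymptoticEigenvalueDistribution {Ω : Type*} [MeasurableSpace Ω] (P : Measure Ω)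
    {M N : ℕ → ℕ} (A : ∀ k, Ω → Matrix (Fin (M k)) (Fin (N k)) ℝ) (ν : Measure ℝ) : Prop :=
  ∀ᵐ ω ∂P, ∀ f : BoundedContinuousFunction ℝ ℝ,
    Tendsto (fun k => empiricalSpectralMean (A k ω) f) atTop (𝓝 (∫ x, f x ∂ν))

/-- `μ j` is the `j`-th asymptotic moment: almost surely `N⁻¹ Tr ((Aᵀ A) ^ j)` tends to `μ j`. -/
def HasAsymptoticMoments {Ω : Type*} [MeasurableSpace Ω] (P : Measure Ω)
    {M N : ℕ → ℕ} (A : ∀ k, Ω → Matrix (Fin (M k)) (Fin (N k)) ℝ) (μ : ℕ → ℝ) : Prop :=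
  ∀ j : ℕ, ∀ᵐ ω ∂P,
    Tendsto (fun k => (((A k ω).transpose * A k ω) ^ j).trace / (N k : ℝ)) atTop (𝓝 (μ j))

/-! ### The eta-transform and the R-transform -/

/-- The eta-transform `η(z) = ∫ 1 / (1 + z x) dν(x)`, for `z ≥ 0`, of an eigenvalue distribution
`ν` on `[0, ∞)`. -/
def etaTransform (ν : Measure ℝ) (z : ℝ) : ℝ := ∫ x, 1 / (1 + z * x) ∂ν

/-- The R-transform on the negative half-line, given implicitly by
`R(-z η(z)) = (1 - η(z)) / (z η(z))` for `z > 0`, i.e. `η(z) = 1 / (1 + z R(-z η(z)))`: at `u < 0`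
it is computed from the solution `z > 0` of `z η(z) = -u`. -/
def rTransformNeg (ν : Measure ℝ) (u : ℝ) : ℝ :=
  let z := Function.invFunOn (fun z => z * etaTransform ν z) (Set.Ioi 0) (-u)
  (1 - etaTransform ν z) / (z * etaTransform ν z)

/-- The R-transform on `(-∞, 0]`, with `R(0)` the limit of `R(u)` as `u ↑ 0`. -/
def rTransform (ν : Measure ℝ) (u : ℝ) : ℝ :=
  if u < 0 then rTransformNeg ν u else limUnder (𝓝[<] (0 : ℝ)) (rTransformNeg ν)

/-! ### The signal -/

/-- The joint law of `(x, √s x + z)` where `x` has law `p` and `z` is standard Gaussian and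
independent of `x`. -/
def awgnJoint (p : Measure ℝ) (s : ℝ) : Measure (ℝ × ℝ) :=
  Measure.map (fun q : ℝ × ℝ => (q.1, Real.sqrt s * q.1 + q.2)) (p.prod (gaussianReal 0 1))

/-- The mutual information `I(s) = I(x; √s x + z)` in nats: the Kullback-Leibler divergence of the
joint law from the product of its marginals. -/
def mutualInfo (p : Measure ℝ) (s : ℝ) : ℝ :=
  (InformationTheory.klDiv (awgnJoint p s) ((awgnJoint p s).fst.prod (awgnJoint p s).snd)).toReal

/-- The Shannon entropy (in nats) of the discretization `⌊n x⌋ / n` of `x` with law `p`. -/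
def discretizedEntropy (p : Measure ℝ) (n : ℕ) : ℝ :=
  ∑' k : ℤ, Real.negMulLog (p.real {x | ⌊(n : ℝ) * x⌋ = k})

/-- A random variable with law `p` has Rényi information dimension `d`. -/
def HasInformationDimension (p : Measure ℝ) (d : ℝ) : Prop :=
  Tendsto (fun n : ℕ => discretizedEntropy p n / Real.log n) atTop (𝓝 d)

/-! ### The replica-symmetric potential and its optimizers -/

/-- The replica-symmetric potential `f_RS(E, s)` at noise variance `v = σ²`. -/
def rsPotential (ν p : Measure ℝ) (v E s : ℝ) : ℝ :=
  mutualInfo p s + 1 / 2 * (∫ z in (0 : ℝ)..(E / v), rTransform ν (-z)) - s * E / 2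

/-- `(E, s)` is an optimizer of the problem `inf_{s ≥ 0} sup_{E ∈ [0, 1]} f_RS(E, s)` at noise
variance `v`: `s` attains the outer infimum and `E` attains the inner supremum at this `s`. -/
def IsOptimizer (ν p : Measure ℝ) (v E s : ℝ) : Prop :=
  E ∈ Set.Icc (0 : ℝ) 1 ∧ s ∈ Set.Ici (0 : ℝ) ∧
  IsMaxOn (fun E' => rsPotential ν p v E' s) (Set.Icc 0 1) E ∧
  IsMinOn (fun s' => ⨆ E' : Set.Icc (0 : ℝ) 1, rsPotential ν p v E' s') (Set.Ici 0) s

/-- `(E, s)`, with `s` possibly infinite, is an optimizer in the limit `v = σ² ↓ 0`: every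
neighbourhood of it contains optimizers at arbitrarily small noise variances. -/
def IsLimitOptimizer (ν p : Measure ℝ) (q : ℝ × EReal) : Prop :=
  ∀ W ∈ 𝓝 q, ∃ᶠ v in 𝓝[>] (0 : ℝ), ∃ E s : ℝ, IsOptimizer ν p v E s ∧ (E, (s : EReal)) ∈ W

end

end CompressedSensing

namespace CompressedSensing

/-! ### The asymptotic eigenvalue distribution -/

/-! Both sides of the potential grow logarithmically, and the theorem compares the two rates. Write
`G(x) = ∫₀ˣ R(-z) dz`.

Rate of `G`: if `z η(z) = u` then `u R(-u) = 1 - η(z)`, which is at most `1 - ν{0} = δ` and tends to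
`δ` as `u → ∞`. The hypothesis `δ < 1` or `∫ λ⁻¹ dν = ∞` makes `z η(z)` unbounded, so that `R` is
given by this formula on the whole negative half-line. Hence `G(b) - G(a) ≤ δ log (b/a)`
(`integral_rTransform_sub_le_log`), and `G(x) ≥ c log x` eventually for each `c < δ`
(`eventually_mul_log_le_integral_rTransform`). By Jensen `R(-u) ≤ ∫ λ dν`, so `G` is also at most
linear.

Rate of `I`: the mutual information at `s = n²` is the entropy of `⌊n x⌋` up to `O(1)`, and `I` is
monotone in `s`, so `I(s) ~ (d/2) log s` in the sense of `tendsto_mutualInfo_div_log`.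

Optimizers are then located by trial points. If `d < δ`, the rival `s' = c/v` costs at most about
`(d/2) log (1/v)`, whereas a bounded `s` costs about `(δ/2) log (1/v)` already at `E = 1`; so `s →
∞`, and `s E ≤ 2 log 2` (compare `E` with `E/2`) gives `E → 0`. If `d > δ`, the rival `s' = 0` and
the trial `E = 1/s` give `I(s) ≤ (δ/2) log s + O(1)` uniformly in `v`, which bounds `s`. -/

theorem gram_eigenvalues_nonneg {m n : ℕ} (A : Matrix (Fin m) (Fin n) ℝ) (i : Fin n) :
    0 ≤ (isHermitian_gram A).eigenvalues i := by
  have h : (A.transpose * A).PosSemidef := by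
    simpa [Matrix.conjTranspose_eq_transpose_of_trivial] using
      Matrix.posSemidef_conjTranspose_mul_self A
  exact h.eigenvalues_nonneg i

theorem trace_gram_eq_sum {m n : ℕ} (A : Matrix (Fin m) (Fin n) ℝ) :
    (A.transpose * A).trace = ∑ i, (isHermitian_gram A).eigenvalues i := by
  simpa using (isHermitian_gram A).trace_eq_sum_eigenvalues

/-- The clamp of `c * x` to the interval `[0, K]`, as a bounded continuous function. -/
noncomputable def clamp (c K : ℝ) (hK : 0 ≤ K) : BoundedContinuousFunction ℝ ℝ :=
  BoundedContinuousFunction.ofNormedAddCommGroup (fun x => min (max (c * x) 0) K)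
    (by fun_prop) K (fun x => by
      rw [Real.norm_of_nonneg (le_min (le_max_right _ _) hK)]
      exact min_le_right _ _)

theorem clamp_apply (c K : ℝ) (hK : 0 ≤ K) (x : ℝ) : clamp c K hK x = min (max (c * x) 0) K := rfl

theorem clamp_nonneg (c K : ℝ) (hK : 0 ≤ K) (x : ℝ) : 0 ≤ clamp c K hK x :=
  le_min (le_max_right _ _) hK

section Spectrum

variable {Ω : Type*} [MeasurableSpace Ω] {P : Measure Ω} [IsProbabilityMeasure P]
  {M N : ℕ → ℕ} {A : ∀ k, Ω → Matrix (Fin (M k)) (Fin (N k)) ℝ}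
  {ν : Measure ℝ} [IsProbabilityMeasure ν]

/-- The truncated negative part vanishes on the spectrum of every Gram matrix, so its limiting
integral is zero. -/
theorem IsAsymptoticEigenvalueDistribution.ae_nonneg
    (hν : IsAsymptoticEigenvalueDistribution P A ν) : ∀ᵐ x ∂ν, 0 ≤ x := by
  obtain ⟨ω, hω⟩ := hν.exists
  have h := hω (clamp (-1) 1 zero_le_one)
  have h0 : ∀ k, empiricalSpectralMean (A k ω) (clamp (-1) 1 zero_le_one) = 0 := fun k => by
    have : ∀ i, clamp (-1) 1 zero_le_one ((isHermitian_gram (A k ω)).eigenvalues i) = 0 :=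
      fun i => by
        have := gram_eigenvalues_nonneg (A k ω) i
        rw [clamp_apply, max_eq_right (by linarith), min_eq_left zero_le_one]
    simp [empiricalSpectralMean, this]
  simp only [h0] at h
  have h1 : ∫ x, clamp (-1) 1 zero_le_one x ∂ν = 0 := tendsto_nhds_unique h tendsto_const_nhds
  rw [integral_eq_zero_iff_of_nonneg (fun x => clamp_nonneg _ _ _ x)
    (BoundedContinuousFunction.integrable _ _)] at h1
  filter_upwards [h1] with x hx
  by_contra hneg
  push Not at hneg
  have : 0 < clamp (-1) 1 zero_le_one x := by
    rw [clamp_apply]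
    exact lt_min (lt_max_of_lt_left (by linarith)) one_pos
  exact this.ne' hx

/-- Weak convergence only sees bounded test functions: each truncation of `x` has integral at most
`μ 1`, and monotone convergence removes the truncation. -/
theorem IsAsymptoticEigenvalueDistribution.integrable_id
    (hν : IsAsymptoticEigenvalueDistribution P A ν) {μ : ℕ → ℝ} (hμ : HasAsymptoticMoments P A μ) :
    Integrable (fun x : ℝ => x) ν := by
  obtain ⟨ω, hω, hω'⟩ := (hν.and (hμ 1)).exists
  have key : ∀ n : ℕ, ∫ x, clamp 1 n n.cast_nonneg x ∂ν ≤ μ 1 := fun n => by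
    refine le_of_tendsto_of_tendsto' (hω _) hω' fun k => ?_
    rw [pow_one, trace_gram_eq_sum]
    refine div_le_div_of_nonneg_right (Finset.sum_le_sum fun i _ => ?_) (Nat.cast_nonneg _)
    rw [clamp_apply, one_mul, max_eq_left (gram_eigenvalues_nonneg _ i)]
    exact min_le_left _ _
  have hlim : Tendsto (fun n : ℕ => ∫⁻ x, ENNReal.ofReal (clamp 1 n n.cast_nonneg x) ∂ν) atTop
      (𝓝 (∫⁻ x, ENNReal.ofReal x ∂ν)) := by
    refine lintegral_tendsto_of_tendsto_of_monotone
      (fun n => (clamp 1 n n.cast_nonneg).continuous.measurable.ennreal_ofReal.aemeasurable)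
      (ae_of_all _ fun x n n' hnn => ENNReal.ofReal_le_ofReal ?_) (ae_of_all _ fun x => ?_)
    · exact min_le_min le_rfl (by exact_mod_cast hnn)
    · have h1 : ENNReal.ofReal x = ENNReal.ofReal (max (1 * x) 0) := by
        simp [ENNReal.ofReal_max]
      rw [h1]
      refine tendsto_const_nhds.congr' ?_
      filter_upwards [eventually_ge_atTop ⌈max (1 * x) 0⌉₊] with n hn
      rw [clamp_apply, min_eq_left (Nat.ceil_le.mp hn)]
  have hle : ∫⁻ x, ENNReal.ofReal x ∂ν ≤ ENNReal.ofReal (μ 1) := by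
    refine le_of_tendsto' hlim fun n => ?_
    rw [← ofReal_integral_eq_lintegral_ofReal (BoundedContinuousFunction.integrable _ _)
      (ae_of_all _ fun x => clamp_nonneg _ _ _ x)]
    exact ENNReal.ofReal_le_ofReal (key n)
  refine (lintegral_ofReal_ne_top_iff_integrable (by fun_prop) hν.ae_nonneg).mp ?_
  exact ne_top_of_le_ne_top ENNReal.ofReal_ne_top hle

end Spectrum

/-! ### The eta-transform -/

theorem one_div_one_add_mul_mem {ν : Measure ℝ} (hpos : ∀ᵐ x ∂ν, 0 ≤ x) {z : ℝ} (hz : 0 ≤ z) :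
    ∀ᵐ x ∂ν, 0 ≤ 1 / (1 + z * x) ∧ 1 / (1 + z * x) ≤ 1 := by
  filter_upwards [hpos] with x hx
  have : 0 ≤ z * x := mul_nonneg hz hx
  exact ⟨by positivity, div_le_one_of_le₀ (by linarith) (by linarith)⟩

theorem measurable_one_div_one_add_mul (z : ℝ) : Measurable fun x : ℝ => 1 / (1 + z * x) :=
  measurable_const.div (measurable_const.add (measurable_const.mul measurable_id))

section Eta

variable {ν : Measure ℝ} [IsProbabilityMeasure ν]

theorem integrable_one_div_one_add_mul (hpos : ∀ᵐ x ∂ν, 0 ≤ x) {z : ℝ} (hz : 0 ≤ z) :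
    Integrable (fun x => 1 / (1 + z * x)) ν := by
  refine Integrable.of_bound (C := 1) (measurable_one_div_one_add_mul z).aestronglyMeasurable ?_
  filter_upwards [one_div_one_add_mul_mem hpos hz] with x hx
  rw [Real.norm_of_nonneg hx.1]
  exact hx.2

theorem etaTransform_le_one (hpos : ∀ᵐ x ∂ν, 0 ≤ x) {z : ℝ} (hz : 0 ≤ z) :
    etaTransform ν z ≤ 1 := by
  have := integral_mono_ae (integrable_one_div_one_add_mul hpos hz) (integrable_const (1 : ℝ))
    ((one_div_one_add_mul_mem hpos hz).mono fun x hx => hx.2)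
  simpa [etaTransform] using this

theorem etaTransform_antitoneOn (hpos : ∀ᵐ x ∂ν, 0 ≤ x) :
    AntitoneOn (etaTransform ν) (Set.Ici 0) := by
  intro z hz w hw hzw
  refine integral_mono_ae (integrable_one_div_one_add_mul hpos hw)
    (integrable_one_div_one_add_mul hpos hz) ?_
  filter_upwards [hpos] with x hx
  have : 0 ≤ z * x := mul_nonneg hz hx
  have : z * x ≤ w * x := by gcongr
  exact one_div_le_one_div_of_le (by linarith) (by linarith)

theorem mul_etaTransform_monotoneOn (hpos : ∀ᵐ x ∂ν, 0 ≤ x) :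
    MonotoneOn (fun z => z * etaTransform ν z) (Set.Ici 0) := by
  intro z hz w hw hzw
  simp only [etaTransform, ← integral_const_mul]
  refine integral_mono_ae ((integrable_one_div_one_add_mul hpos hz).const_mul _)
    ((integrable_one_div_one_add_mul hpos hw).const_mul _) ?_
  filter_upwards [hpos] with x hx
  have h1 : 0 ≤ z * x := mul_nonneg hz hx
  have h2 : 0 ≤ w * x := mul_nonneg hw hx
  rw [mul_one_div, mul_one_div, div_le_div_iff₀ (by linarith) (by linarith)]
  nlinarith

theorem mul_etaTransform_le (hpos : ∀ᵐ x ∂ν, 0 ≤ x) {z : ℝ} (hz : 0 ≤ z) :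
    z * etaTransform ν z ≤ z :=
  mul_le_of_le_one_right hz (etaTransform_le_one hpos hz)

theorem continuousOn_etaTransform (hpos : ∀ᵐ x ∂ν, 0 ≤ x) :
    ContinuousOn (etaTransform ν) (Set.Ici 0) := by
  refine continuousOn_of_dominated (bound := fun _ => 1) 
    (fun z hz => (measurable_one_div_one_add_mul z).aestronglyMeasurable) (fun z hz => ?_)
    (integrable_const _) ?_
  · filter_upwards [one_div_one_add_mul_mem hpos hz] with x hx
    rw [Real.norm_of_nonneg hx.1]
    exact hx.2
  · filter_upwards [hpos] with x hx z hz
    have : 0 ≤ z * x := mul_nonneg hz hx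
    exact ContinuousAt.continuousWithinAt
      (by have : (1 + z * x) ≠ 0 := by linarith
          fun_prop (disch := assumption))

/-- Jensen's inequality for the eta-transform. -/
theorem one_div_le_etaTransform (hpos : ∀ᵐ x ∂ν, 0 ≤ x) (hint : Integrable (fun x : ℝ => x) ν)
    {z : ℝ} (hz : 0 ≤ z) : 1 / (1 + z * ∫ x, x ∂ν) ≤ etaTransform ν z := by
  have hm : 0 ≤ ∫ x, x ∂ν := integral_nonneg_of_ae hpos
  set c := 1 + z * ∫ x, x ∂ν with hc
  have hc1 : 0 < c := by positivity
  have hlin : Integrable (fun x => z / c ^ 2 * x) ν := hint.const_mul _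
  -- The minorant is the tangent line of `y ↦ 1 / y` at `y = c`, evaluated at `y = 1 + z x`.
  have h : ∫ x, ((2 / c - 1 / c ^ 2) - z / c ^ 2 * x) ∂ν ≤ etaTransform ν z := by
    refine integral_mono_ae ((integrable_const _).sub hlin)
      (integrable_one_div_one_add_mul hpos hz) ?_
    filter_upwards [hpos] with x hx
    have h1 : 0 < 1 + z * x := by positivity
    have : 1 / (1 + z * x) - ((2 / c - 1 / c ^ 2) - z / c ^ 2 * x)
        = (1 + z * x - c) ^ 2 / (c ^ 2 * (1 + z * x)) := by
      field_simp
      ring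
    have h2 : 0 ≤ (1 + z * x - c) ^ 2 / (c ^ 2 * (1 + z * x)) := by positivity
    linarith
  rw [integral_sub (integrable_const _) hlin, integral_const_mul] at h
  refine le_trans (le_of_eq ?_) h
  have : z * ∫ x, x ∂ν = c - 1 := by rw [hc]; ring
  simp only [integral_const, probReal_univ, one_smul]
  rw [div_mul_eq_mul_div, this]
  field_simp
  ring

/-- The integrand is dominated by one and tends pointwise to the indicator of `{0}`. This is how the
atom, hence `δ`, enters the asymptotics. -/
theorem tendsto_etaTransform_atTop (hpos : ∀ᵐ x ∂ν, 0 ≤ x) :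
    Tendsto (etaTransform ν) atTop (𝓝 (ν.real {0})) := by
  have h0 : ν.real {0} = ∫ x, Set.indicator {0} (fun _ => (1 : ℝ)) x ∂ν := by
    rw [integral_indicator_const _ (measurableSet_singleton _)]
    simp
  rw [h0]
  refine tendsto_integral_filter_of_dominated_convergence (fun _ => 1)
    (Eventually.of_forall fun z => (measurable_one_div_one_add_mul z).aestronglyMeasurable) ?_
    (integrable_const _) ?_
  · filter_upwards [eventually_ge_atTop 0] with z hz
    filter_upwards [one_div_one_add_mul_mem hpos hz] with x hx
    rw [Real.norm_of_nonneg hx.1]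
    exact hx.2
  · filter_upwards [hpos] with x hx
    rcases hx.eq_or_lt with rfl | hx
    · simp
    · simp only [Set.indicator, Set.mem_singleton_iff, hx.ne', if_false]
      refine Tendsto.div_atTop tendsto_const_nhds (tendsto_atTop_add_const_left _ _ ?_)
      exact tendsto_id.atTop_mul_const hx

theorem le_etaTransform (hpos : ∀ᵐ x ∂ν, 0 ≤ x) {z : ℝ} (hz : 0 ≤ z) :
    ν.real {0} ≤ etaTransform ν z := by
  refine le_of_tendsto (tendsto_etaTransform_atTop hpos) ?_
  filter_upwards [eventually_ge_atTop z] with w hw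
  exact etaTransform_antitoneOn hpos hz (hz.trans hw) hw

theorem tendsto_mul_etaTransform_of_pos (hpos : ∀ᵐ x ∂ν, 0 ≤ x) (h : 0 < ν.real {0}) :
    Tendsto (fun z => z * etaTransform ν z) atTop atTop :=
  tendsto_id.atTop_mul_pos h (tendsto_etaTransform_atTop hpos)

/-- The functions `z / (1 + z x)` increase to `1 / x`, so monotone convergence along the integers
gives divergence; monotonicity of `z η(z)` extends it to real `z`. -/
theorem tendsto_mul_etaTransform_of_lintegral_inv (hpos : ∀ᵐ x ∂ν, 0 ≤ x) (h0 : ν.real {0} = 0)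
    (h : ∫⁻ x, (ENNReal.ofReal x)⁻¹ ∂ν = ⊤) :
    Tendsto (fun z => z * etaTransform ν z) atTop atTop := by
  have hpos' : ∀ᵐ x ∂ν, 0 < x := by
    have : ∀ᵐ x ∂ν, x ≠ 0 := by
      rw [ae_iff]
      simpa [Measure.real, ENNReal.toReal_eq_zero_iff] using h0
    filter_upwards [hpos, this] with x h1 h2 using lt_of_le_of_ne h1 h2.symm
  have hlim : Tendsto (fun n : ℕ => ∫⁻ x, ENNReal.ofReal (n * (1 / (1 + n * x))) ∂ν) atTop
      (𝓝 ⊤) := by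
    rw [← h]
    refine lintegral_tendsto_of_tendsto_of_monotone (fun n => by fun_prop) ?_ ?_
    · filter_upwards [hpos] with x hx a b hab
      refine ENNReal.ofReal_le_ofReal ?_
      have hab' : (a : ℝ) ≤ b := by exact_mod_cast hab
      rw [mul_one_div, mul_one_div, div_le_div_iff₀ (by positivity) (by positivity)]
      nlinarith
    · filter_upwards [hpos'] with x hx
      rw [← ENNReal.ofReal_inv_of_pos hx]
      refine (ENNReal.continuous_ofReal.tendsto _).comp ?_
      have h1 : Tendsto (fun n : ℕ => ((n : ℝ)⁻¹ + x)⁻¹) atTop (𝓝 (0 + x)⁻¹) :=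
        (tendsto_inv_atTop_nhds_zero_nat.add_const x).inv₀ (by simpa using hx.ne')
      rw [zero_add] at h1
      refine h1.congr' ?_
      filter_upwards [eventually_gt_atTop 0] with n hn
      have : (0 : ℝ) < n := by exact_mod_cast hn
      field_simp
  have heq : ∀ n : ℕ, ∫⁻ x, ENNReal.ofReal (n * (1 / (1 + n * x))) ∂ν
      = ENNReal.ofReal (n * etaTransform ν n) := fun n => by
    rw [etaTransform, ← integral_const_mul, ofReal_integral_eq_lintegral_ofReal
      ((integrable_one_div_one_add_mul hpos n.cast_nonneg).const_mul _)]
    filter_upwards [one_div_one_add_mul_mem hpos (z := n) n.cast_nonneg] with x hx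
    exact mul_nonneg n.cast_nonneg hx.1
  simp only [heq] at hlim
  rw [ENNReal.tendsto_nhds_top_iff_nnreal] at hlim
  refine tendsto_atTop.mpr fun b => ?_
  obtain ⟨n, hn⟩ := (hlim b.toNNReal).exists
  filter_upwards [eventually_ge_atTop (n : ℝ)] with z hz
  have hn' : b < n * etaTransform ν n := by
    by_contra hcon
    push Not at hcon
    exact absurd hn (not_lt.mpr (ENNReal.ofReal_le_ofReal hcon))
  exact hn'.le.trans
    (mul_etaTransform_monotoneOn hpos (Set.mem_Ici.mpr n.cast_nonneg)
      (Set.mem_Ici.mpr (n.cast_nonneg.trans hz)) hz)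

/-! ### The R-transform -/

/-- The solution `z > 0` of `z η(z) = u` that is used to compute `R(-u)`. -/
noncomputable def etaInv (ν : Measure ℝ) (u : ℝ) : ℝ :=
  Function.invFunOn (fun z => z * etaTransform ν z) (Set.Ioi 0) u

/-- Intermediate value theorem; unboundedness of `z η(z)` guarantees that every `u > 0` is attained,
so `invFunOn` never returns its default value. -/
theorem etaInv_spec (hpos : ∀ᵐ x ∂ν, 0 ≤ x)
    (htop : Tendsto (fun z => z * etaTransform ν z) atTop atTop) {u : ℝ} (hu : 0 < u) :
    0 < etaInv ν u ∧ etaInv ν u * etaTransform ν (etaInv ν u) = u := by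
  have hc : ContinuousOn (fun z => z * etaTransform ν z) (Set.Ici 0) :=
    continuousOn_id.mul (continuousOn_etaTransform hpos)
  have hmem : u ∈ (fun z => z * etaTransform ν z) '' Set.Ioi 0 :=
    intermediate_value_Ioi hc htop (by simpa using hu)
  exact ⟨Function.invFunOn_mem hmem, Function.invFunOn_eq hmem⟩

theorem rTransform_neg_eq (hpos : ∀ᵐ x ∂ν, 0 ≤ x)
    (htop : Tendsto (fun z => z * etaTransform ν z) atTop atTop) {u : ℝ} (hu : 0 < u) :
    rTransform ν (-u) = (1 - etaTransform ν (etaInv ν u)) / u := by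
  have h := (etaInv_spec hpos htop hu).2
  rw [etaInv] at h ⊢
  simp only [rTransform, neg_lt_zero.mpr hu, if_true, rTransformNeg, neg_neg]
  rw [h]

/-- Weak monotonicity of `z η(z)` suffices: a reversed order of the solutions would force `u = w`,
and then the solutions coincide. -/
theorem etaInv_monotoneOn (hpos : ∀ᵐ x ∂ν, 0 ≤ x)
    (htop : Tendsto (fun z => z * etaTransform ν z) atTop atTop) :
    MonotoneOn (etaInv ν) (Set.Ioi 0) := by
  intro u hu w hw huw
  by_contra! h
  obtain ⟨h1, h2⟩ := etaInv_spec hpos htop hu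
  obtain ⟨h3, h4⟩ := etaInv_spec hpos htop hw
  have := mul_etaTransform_monotoneOn hpos h3.le h1.le h.le
  simp only [h2, h4] at this
  have huw' := le_antisymm huw this
  subst huw'
  exact lt_irrefl _ h

theorem rTransform_neg_nonneg (hpos : ∀ᵐ x ∂ν, 0 ≤ x)
    (htop : Tendsto (fun z => z * etaTransform ν z) atTop atTop) {u : ℝ} (hu : 0 < u) :
    0 ≤ rTransform ν (-u) := by
  rw [rTransform_neg_eq hpos htop hu]
  exact div_nonneg
    (sub_nonneg.mpr (etaTransform_le_one hpos (etaInv_spec hpos htop hu).1.le)) hu.le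

/-- With `m` the mean, Jensen gives `1 ≤ η(z) (1 + z m)`, that is, `1 - η(z) ≤ z η(z) m = u m`. -/
theorem rTransform_neg_le_mean (hpos : ∀ᵐ x ∂ν, 0 ≤ x) (hint : Integrable (fun x : ℝ => x) ν)
    (htop : Tendsto (fun z => z * etaTransform ν z) atTop atTop) {u : ℝ} (hu : 0 < u) :
    rTransform ν (-u) ≤ ∫ x, x ∂ν := by
  obtain ⟨h1, h2⟩ := etaInv_spec hpos htop hu
  rw [rTransform_neg_eq hpos htop hu, div_le_iff₀ hu]
  have h3 := one_div_le_etaTransform hpos hint h1.le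
  have hm : 0 ≤ ∫ x, x ∂ν := integral_nonneg_of_ae hpos
  rw [div_le_iff₀ (by positivity)] at h3
  have : (∫ x, x ∂ν) * u = etaTransform ν (etaInv ν u) * (etaInv ν u * ∫ x, x ∂ν) := by
    nth_rewrite 1 [← h2]
    ring
  linarith

theorem mul_rTransform_neg_le (hpos : ∀ᵐ x ∂ν, 0 ≤ x)
    (htop : Tendsto (fun z => z * etaTransform ν z) atTop atTop) {u : ℝ} (hu : 0 < u) :
    u * rTransform ν (-u) ≤ 1 - ν.real {0} := by
  rw [rTransform_neg_eq hpos htop hu, mul_div_cancel₀ _ hu.ne']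
  linarith [le_etaTransform hpos (etaInv_spec hpos htop hu).1.le]

theorem tendsto_mul_rTransform_neg (hpos : ∀ᵐ x ∂ν, 0 ≤ x)
    (htop : Tendsto (fun z => z * etaTransform ν z) atTop atTop) :
    Tendsto (fun u => u * rTransform ν (-u)) atTop (𝓝 (1 - ν.real {0})) := by
  -- Since `η ≤ 1`, the solution of `z η(z) = u` satisfies `z ≥ u`.
  have hinv : Tendsto (etaInv ν) atTop atTop := by
    refine tendsto_atTop_mono' _ ?_ tendsto_id
    filter_upwards [eventually_gt_atTop 0] with u hu
    obtain ⟨h1, h2⟩ := etaInv_spec hpos htop hu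
    have := mul_etaTransform_le hpos h1.le
    rwa [h2] at this
  refine (((tendsto_etaTransform_atTop hpos).comp hinv).const_sub 1).congr' ?_
  filter_upwards [eventually_gt_atTop 0] with u hu
  rw [rTransform_neg_eq hpos htop hu, mul_div_cancel₀ _ hu.ne', Function.comp]

theorem intervalIntegrable_rTransform_neg (hpos : ∀ᵐ x ∂ν, 0 ≤ x)
    (hint : Integrable (fun x : ℝ => x) ν)
    (htop : Tendsto (fun z => z * etaTransform ν z) atTop atTop) {a b : ℝ} (ha : 0 ≤ a)
    (hb : 0 ≤ b) : IntervalIntegrable (fun u => rTransform ν (-u)) volume a b := by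
  -- Measurability comes from monotonicity of `1 - η ∘ etaInv`. Only positive arguments matter, so
  -- the value of `R` at zero plays no role.
  have hmeas : AEMeasurable (fun u => (1 - etaTransform ν (etaInv ν u)) / u)
      (volume.restrict (Set.Ioi 0)) := by
    refine AEMeasurable.div ?_ aemeasurable_id
    refine aemeasurable_restrict_of_monotoneOn measurableSet_Ioi fun u hu w hw huw => ?_
    refine sub_le_sub_left ?_ _
    exact etaTransform_antitoneOn hpos (etaInv_spec hpos htop hu).1.le
      (etaInv_spec hpos htop hw).1.le (etaInv_monotoneOn hpos htop hu hw huw)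
  have hsub : Set.uIoc a b ⊆ Set.Ioi 0 := fun x hx => by
    rcases Set.mem_uIoc.mp hx with h | h
    · exact ha.trans_lt h.1
    · exact hb.trans_lt h.1
  rw [intervalIntegrable_iff]
  have : IsFiniteMeasure (volume.restrict (Set.uIoc a b)) := ⟨by simp [Set.uIoc]⟩
  refine Integrable.of_bound (C := ∫ x, x ∂ν) ?_ ?_
  · refine (AEMeasurable.congr (hmeas.mono_set hsub) ?_).aestronglyMeasurable
    refine (ae_restrict_iff' measurableSet_uIoc).mpr (ae_of_all _ fun u hu => ?_)
    exact (rTransform_neg_eq hpos htop (hsub hu)).symm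
  · refine (ae_restrict_iff' measurableSet_uIoc).mpr (ae_of_all _ fun u hu => ?_)
    rw [Real.norm_of_nonneg (rTransform_neg_nonneg hpos htop (hsub hu))]
    exact rTransform_neg_le_mean hpos hint htop (hsub hu)

end Eta

/-! ### Densities of the Gaussian channel -/

theorem gaussianPDFReal_one (m y : ℝ) :
    gaussianPDFReal m 1 y = (√(2 * Real.pi))⁻¹ * Real.exp (-(y - m) ^ 2 / 2) := by
  simp [gaussianPDFReal]

theorem gaussianPDFReal_one_pos (m y : ℝ) : 0 < gaussianPDFReal m 1 y :=
  gaussianPDFReal_pos _ _ _ one_ne_zero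

theorem gaussianPDFReal_one_le (m y : ℝ) : gaussianPDFReal m 1 y ≤ (√(2 * Real.pi))⁻¹ := by
  rw [gaussianPDFReal_one]
  refine mul_le_of_le_one_right (by positivity) (Real.exp_le_one_iff.mpr ?_)
  have : 0 ≤ (y - m) ^ 2 := sq_nonneg _
  linarith

theorem continuous_gaussianPDFReal_one :
    Continuous fun q : ℝ × ℝ => gaussianPDFReal q.1 1 q.2 := by
  simp only [gaussianPDFReal_one]
  fun_prop

/-- Two Gaussian densities whose means are at distance at most one are comparable. -/
theorem gaussianPDFReal_one_mul_exp_le {m m' : ℝ} (h : |m - m'| ≤ 1) (y : ℝ) :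
    gaussianPDFReal m 1 y * Real.exp (-(|y - m| + 1 / 2)) ≤ gaussianPDFReal m' 1 y := by
  rw [gaussianPDFReal_one, gaussianPDFReal_one, mul_assoc, ← Real.exp_add]
  refine mul_le_mul_of_nonneg_left (Real.exp_le_exp.mpr ?_) (by positivity)
  have h1 : -((y - m) * (m - m')) ≤ |y - m| := by
    refine (neg_le_abs _).trans ?_
    rw [abs_mul]
    exact mul_le_of_le_one_right (abs_nonneg _) h
  have h2 : (m - m') ^ 2 ≤ 1 := by
    rw [← sq_abs]
    exact pow_le_one₀ (abs_nonneg _) h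
  have h3 : |y - m| * |y - m| = (y - m) * (y - m) := abs_mul_abs_self _
  have h1' : (y - m) * (m - m') ≤ |y - m| := by
    refine (le_abs_self _).trans ?_
    rw [abs_mul]
    exact mul_le_of_le_one_right (abs_nonneg _) h
  have e : (y - m') = (y - m) + (m - m') := by ring
  rw [e]
  nlinarith

/-- Stability of the normal law: it realizes a channel of lower signal-to-noise ratio as a rescaled
output with fresh noise added. -/
theorem gaussianReal_map_mul_add_mul {α β : ℝ} (h : α ^ 2 + β ^ 2 = 1) :
    ((gaussianReal 0 1).prod (gaussianReal 0 1)).map (fun q : ℝ × ℝ => α * q.1 + β * q.2)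
      = gaussianReal 0 1 := by
  have h1 : ((gaussianReal 0 1).prod (gaussianReal 0 1)).map
      (fun q : ℝ × ℝ => α * q.1 + β * q.2)
      = ((gaussianReal 0 1).map (α * ·)) ∗ ((gaussianReal 0 1).map (β * ·)) := by
    rw [Measure.conv, Measure.map_prod_map _ _ (by fun_prop) (by fun_prop),
      Measure.map_map (by fun_prop) (by fun_prop)]
    rfl
  rw [h1, gaussianReal_map_const_mul, gaussianReal_map_const_mul, gaussianReal_conv_gaussianReal]
  congr 1
  · simp
  · ext
    simpa using h

/-- The density of the channel output `√s x + z`. -/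
noncomputable def outputDensity (p : Measure ℝ) (s y : ℝ) : ℝ :=
  ∫ x, gaussianPDFReal (√s * x) 1 y ∂p

/-- The output distribution of the Gaussian channel. -/
noncomputable def awgnOutput (p : Measure ℝ) (s : ℝ) : Measure ℝ := (awgnJoint p s).snd

/-- The nonnegative integrand that represents the mutual information of the Gaussian channel. -/
noncomputable def infoIntegrand (p : Measure ℝ) (s : ℝ) (q : ℝ × ℝ) : ℝ :=
  gaussianPDFReal (√s * q.1) 1 q.2
      * Real.log (gaussianPDFReal (√s * q.1) 1 q.2 / outputDensity p s q.2)
    + outputDensity p s q.2 - gaussianPDFReal (√s * q.1) 1 q.2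

section Channel

variable {p : Measure ℝ} [IsProbabilityMeasure p]

theorem measurable_channel (s : ℝ) :
    Measurable fun q : ℝ × ℝ => (q.1, √s * q.1 + q.2) := by fun_prop

instance (s : ℝ) : IsProbabilityMeasure (awgnJoint p s) :=
  Measure.isProbabilityMeasure_map (measurable_channel s).aemeasurable

instance (s : ℝ) : IsProbabilityMeasure (awgnOutput p s) := by
  unfold awgnOutput; infer_instance

theorem lintegral_awgnJoint {p : Measure ℝ} (s : ℝ) {f : ℝ × ℝ → ENNReal} (hf : Measurable f) :
    ∫⁻ q, f q ∂awgnJoint p s = ∫⁻ x, ∫⁻ z, f (x, √s * x + z) ∂gaussianReal 0 1 ∂p := by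
  rw [awgnJoint, lintegral_map hf (measurable_channel s), lintegral_prod]
  exact (hf.comp (measurable_channel s)).aemeasurable

theorem lintegral_awgnOutput {p : Measure ℝ} (s : ℝ) {f : ℝ → ENNReal} (hf : Measurable f) :
    ∫⁻ y, f y ∂awgnOutput p s = ∫⁻ x, ∫⁻ z, f (√s * x + z) ∂gaussianReal 0 1 ∂p := by
  rw [awgnOutput, Measure.snd, lintegral_map hf measurable_snd,
    lintegral_awgnJoint s (f := fun q => f q.2) (by fun_prop)]

theorem awgnJoint_fst {p : Measure ℝ} (s : ℝ) : (awgnJoint p s).fst = p := by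
  refine Measure.ext_of_lintegral _ fun f hf => ?_
  rw [Measure.fst, lintegral_map hf measurable_fst,
    lintegral_awgnJoint s (f := fun q => f q.1) (by fun_prop)]
  simp

theorem lintegral_gaussianReal_shift (m : ℝ) {f : ℝ → ENNReal} (hf : Measurable f) :
    ∫⁻ z, f (m + z) ∂gaussianReal 0 1
      = ∫⁻ y, ENNReal.ofReal (gaussianPDFReal m 1 y) * f y := by
  have h1 : (gaussianReal 0 1).map (m + ·) = gaussianReal m 1 := by
    rw [gaussianReal_map_const_add, zero_add]
  rw [← lintegral_map hf (by fun_prop : Measurable (m + ·)), h1,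
    gaussianReal_of_var_ne_zero _ one_ne_zero,
    lintegral_withDensity_eq_lintegral_mul _ (measurable_gaussianPDF _ _) hf]
  rfl

theorem measurable_channelDensity (s : ℝ) :
    Measurable fun q : ℝ × ℝ => gaussianPDFReal (√s * q.1) 1 q.2 :=
  (continuous_gaussianPDFReal_one.comp (by fun_prop :
    Continuous fun q : ℝ × ℝ => (√s * q.1, q.2))).measurable

theorem lintegral_channelDensity_mul {p : Measure ℝ} (s : ℝ) {f : ℝ × ℝ → ENNReal} (hf : Measurable f) :
    ∫⁻ q, ENNReal.ofReal (gaussianPDFReal (√s * q.1) 1 q.2) * f q ∂(p.prod volume)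
      = ∫⁻ x, ∫⁻ z, f (x, √s * x + z) ∂gaussianReal 0 1 ∂p := by
  have h : Measurable fun q : ℝ × ℝ =>
      ENNReal.ofReal (gaussianPDFReal (√s * q.1) 1 q.2) * f q :=
    (measurable_channelDensity s).ennreal_ofReal.mul hf
  rw [lintegral_prod _ h.aemeasurable]
  refine lintegral_congr fun x => ?_
  rw [lintegral_gaussianReal_shift _ (f := fun y => f (x, y)) (by fun_prop)]

theorem awgnJoint_eq_withDensity {p : Measure ℝ} (s : ℝ) : awgnJoint p s = (p.prod volume).withDensity
    fun q => ENNReal.ofReal (gaussianPDFReal (√s * q.1) 1 q.2) := by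
  refine Measure.ext_of_lintegral _ fun f hf => ?_
  rw [lintegral_withDensity_eq_lintegral_mul _ (measurable_channelDensity s).ennreal_ofReal hf,
    lintegral_awgnJoint s hf, ← lintegral_channelDensity_mul s hf]
  rfl

theorem integrable_channelDensity (s y : ℝ) :
    Integrable (fun x => gaussianPDFReal (√s * x) 1 y) p := by
  refine Integrable.of_bound (C := (√(2 * Real.pi))⁻¹) ?_ (ae_of_all _ fun _ => ?_)
  · exact ((measurable_channelDensity s).comp
      (measurable_id.prodMk measurable_const)).aestronglyMeasurable
  · rw [Real.norm_of_nonneg (gaussianPDFReal_nonneg _ _ _)]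
    exact gaussianPDFReal_one_le _ _

theorem ofReal_outputDensity (s y : ℝ) : ENNReal.ofReal (outputDensity p s y)
    = ∫⁻ x, ENNReal.ofReal (gaussianPDFReal (√s * x) 1 y) ∂p :=
  ofReal_integral_eq_lintegral_ofReal (integrable_channelDensity s y)
    (ae_of_all _ fun _ => gaussianPDFReal_nonneg _ _ _)

theorem outputDensity_pos (s y : ℝ) : 0 < outputDensity p s y := by
  refine (integral_pos_iff_support_of_nonneg (fun _ => gaussianPDFReal_nonneg _ _ _)
    (integrable_channelDensity s y)).mpr ?_
  have : (Function.support fun x => gaussianPDFReal (√s * x) 1 y) = Set.univ :=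
    Set.eq_univ_of_forall fun _ => (gaussianPDFReal_one_pos _ _).ne'
  rw [this]
  simp

theorem continuous_outputDensity : Continuous fun q : ℝ × ℝ => outputDensity p q.1 q.2 := by
  refine continuous_of_dominated (bound := fun _ => (√(2 * Real.pi))⁻¹)
    (fun q => (integrable_channelDensity q.1 q.2).aestronglyMeasurable)
    (fun q => ae_of_all _ fun x => ?_) (integrable_const _) (ae_of_all _ fun x => ?_)
  · rw [Real.norm_of_nonneg (gaussianPDFReal_nonneg _ _ _)]
    exact gaussianPDFReal_one_le _ _
  · exact continuous_gaussianPDFReal_one.comp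
      (by fun_prop : Continuous fun q : ℝ × ℝ => (√q.1 * x, q.2))

theorem measurable_outputDensity (s : ℝ) : Measurable (outputDensity p s) :=
  (continuous_outputDensity.comp (by fun_prop : Continuous fun y : ℝ => (s, y))).measurable

theorem measurable_outputDensity_snd (s : ℝ) :
    Measurable fun q : ℝ × ℝ => outputDensity p s q.2 :=
  (measurable_outputDensity s).comp measurable_snd

theorem awgnOutput_eq_withDensity (s : ℝ) : awgnOutput p s
    = (volume : Measure ℝ).withDensity fun y => ENNReal.ofReal (outputDensity p s y) := by
  refine Measure.ext_of_lintegral _ fun f hf => ?_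
  rw [lintegral_withDensity_eq_lintegral_mul _ (measurable_outputDensity s).ennreal_ofReal hf,
    lintegral_awgnOutput s hf]
  have h := lintegral_channelDensity_mul (p := p) s (hf.comp measurable_snd)
  simp only [Function.comp] at h
  rw [← h, lintegral_prod_symm]
  · refine lintegral_congr fun y => ?_
    simp only [Pi.mul_apply, ofReal_outputDensity]
    exact lintegral_mul_const _ ((measurable_channelDensity s).comp
      (measurable_id.prodMk measurable_const)).ennreal_ofReal
  · exact ((measurable_channelDensity s).ennreal_ofReal.mul (hf.comp measurable_snd)).aemeasurable

theorem prod_awgnOutput_eq_withDensity (s : ℝ) : p.prod (awgnOutput p s)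
    = (p.prod volume).withDensity fun q => ENNReal.ofReal (outputDensity p s q.2) := by
  rw [awgnOutput_eq_withDensity]
  exact prod_withDensity_right (measurable_outputDensity s).ennreal_ofReal

theorem lintegral_outputDensity_mul (s : ℝ) {f : ℝ × ℝ → ENNReal} (hf : Measurable f) :
    ∫⁻ q, ENNReal.ofReal (outputDensity p s q.2) * f q ∂(p.prod volume)
      = ∫⁻ q, f q ∂(p.prod (awgnOutput p s)) := by
  rw [prod_awgnOutput_eq_withDensity, lintegral_withDensity_eq_lintegral_mul _
    (measurable_outputDensity_snd s).ennreal_ofReal hf]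
  rfl

/-! ### The mutual information as an integral -/

theorem measurable_infoIntegrand (s : ℝ) : Measurable (infoIntegrand p s) := by
  have h1 := measurable_channelDensity s
  have h2 := measurable_outputDensity_snd (p := p) s
  exact ((h1.mul (h1.div h2).log).add h2).sub h1

/-- With `a` the channel density and `b` the output density, the density ratio is `a / b`, and `b *
klFun (a / b) = a log (a / b) + b - a`. The terms `b - a` make the integrand nonnegative, so it can
be treated by Lebesgue integrals without integrability conditions. -/
theorem klDiv_awgnJoint (s : ℝ) : InformationTheory.klDiv (awgnJoint p s)
    (p.prod (awgnOutput p s)) = ∫⁻ q, ENNReal.ofReal (infoIntegrand p s q) ∂(p.prod volume) := by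
  have h1 := measurable_channelDensity s
  have h2 := measurable_outputDensity_snd (p := p) s
  have hr : Measurable fun q : ℝ × ℝ =>
      ENNReal.ofReal (gaussianPDFReal (√s * q.1) 1 q.2 / outputDensity p s q.2) :=
    (h1.div h2).ennreal_ofReal
  have heq : awgnJoint p s = (p.prod (awgnOutput p s)).withDensity fun q =>
      ENNReal.ofReal (gaussianPDFReal (√s * q.1) 1 q.2 / outputDensity p s q.2) := by
    rw [prod_awgnOutput_eq_withDensity, awgnJoint_eq_withDensity,
      ← withDensity_mul _ h2.ennreal_ofReal hr]
    congr 1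
    ext q
    have hb := outputDensity_pos (p := p) s q.2
    rw [Pi.mul_apply, ← ENNReal.ofReal_mul hb.le, mul_div_cancel₀ _ hb.ne']
  have hac : awgnJoint p s ≪ p.prod (awgnOutput p s) := by
    rw [heq]
    exact withDensity_absolutelyContinuous _ _
  have hrn : (awgnJoint p s).rnDeriv (p.prod (awgnOutput p s)) =ᵐ[p.prod (awgnOutput p s)]
      fun q => ENNReal.ofReal (gaussianPDFReal (√s * q.1) 1 q.2 / outputDensity p s q.2) := by
    have := Measure.rnDeriv_withDensity (p.prod (awgnOutput p s)) hr
    rwa [← heq] at this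
  rw [InformationTheory.klDiv_eq_lintegral_klFun_of_ac hac]
  have hstep : ∫⁻ q, ENNReal.ofReal (InformationTheory.klFun
        ((awgnJoint p s).rnDeriv (p.prod (awgnOutput p s)) q).toReal) ∂(p.prod (awgnOutput p s))
      = ∫⁻ q, ENNReal.ofReal (InformationTheory.klFun
        (gaussianPDFReal (√s * q.1) 1 q.2 / outputDensity p s q.2)) ∂(p.prod (awgnOutput p s)) := by
    refine lintegral_congr_ae ?_
    filter_upwards [hrn] with q hq
    rw [hq, ENNReal.toReal_ofReal]
    exact div_nonneg (gaussianPDFReal_nonneg _ _ _) (outputDensity_pos _ _).le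
  rw [hstep, ← lintegral_outputDensity_mul s
    (f := fun q => ENNReal.ofReal (InformationTheory.klFun
      (gaussianPDFReal (√s * q.1) 1 q.2 / outputDensity p s q.2)))
    (InformationTheory.measurable_klFun.comp (h1.div h2)).ennreal_ofReal]
  refine lintegral_congr fun q => ?_
  have hb := outputDensity_pos (p := p) s q.2
  rw [← ENNReal.ofReal_mul hb.le, InformationTheory.klFun_apply, infoIntegrand]
  congr 1
  field_simp

theorem mutualInfo_eq (s : ℝ) : mutualInfo p s
    = (∫⁻ q, ENNReal.ofReal (infoIntegrand p s q) ∂(p.prod volume)).toReal := by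
  rw [← klDiv_awgnJoint, mutualInfo, awgnJoint_fst]
  rfl

/-- Lower semicontinuity of the mutual information, before conversion to a real number. -/
theorem lowerSemicontinuous_lintegral_infoIntegrand : LowerSemicontinuous fun s =>
    ∫⁻ q, ENNReal.ofReal (infoIntegrand p s q) ∂(p.prod volume) := by
  intro s
  refine lowerSemicontinuousAt_iff_le_liminf.mpr ?_
  -- Fatou's lemma: at each fixed `q` the integrand is continuous in `s`.
  refine le_trans (le_of_eq (lintegral_congr fun q => ?_))
    (lintegral_liminf_le fun s => (measurable_infoIntegrand s).ennreal_ofReal)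
  refine (Tendsto.liminf_eq ?_).symm
  refine (ENNReal.continuous_ofReal.tendsto _).comp (Continuous.tendsto ?_ s)
  have h1 : Continuous fun s => gaussianPDFReal (√s * q.1) 1 q.2 :=
    continuous_gaussianPDFReal_one.comp (by fun_prop : Continuous fun s : ℝ => (√s * q.1, q.2))
  have h2 : Continuous fun s => outputDensity p s q.2 :=
    continuous_outputDensity.comp (by fun_prop : Continuous fun s : ℝ => (s, q.2))
  have h3 : Continuous fun s => gaussianPDFReal (√s * q.1) 1 q.2 / outputDensity p s q.2 :=
    h1.div h2 fun s => (outputDensity_pos s q.2).ne'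
  exact ((h1.mul (h3.log fun s =>
    (div_pos (gaussianPDFReal_one_pos _ _) (outputDensity_pos s q.2)).ne')).add h2).sub h1

/-! ### Monotonicity in the signal-to-noise ratio -/

/-- The mutual information decreases when the channel is degraded. -/
theorem klDiv_awgnJoint_mono {s s' : ℝ} (hs' : 0 ≤ s') (hss : s' ≤ s) :
    InformationTheory.klDiv (awgnJoint p s') (p.prod (awgnOutput p s'))
      ≤ InformationTheory.klDiv (awgnJoint p s) (p.prod (awgnOutput p s)) := by
  rcases hss.eq_or_lt with rfl | hlt
  · exact le_rfl
  have hs : 0 < s := hs'.trans_lt hlt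
  -- `α` rescales the signal from `√s` to `√s'`, and `β` restores unit noise variance.
  set α := √(s' / s) with hα
  set β := √(1 - s' / s) with hβ
  have hratio : s' / s ≤ 1 := div_le_one_of_le₀ hss hs.le
  have hαβ : α ^ 2 + β ^ 2 = 1 := by
    rw [hα, hβ, Real.sq_sqrt (div_nonneg hs' hs.le), Real.sq_sqrt (by linarith)]
    ring
  have hαs : α * √s = √s' := by
    rw [hα, ← Real.sqrt_mul (div_nonneg hs' hs.le), div_mul_cancel₀ _ hs.ne']
  let g : (ℝ × ℝ) × ℝ → ℝ × ℝ := fun r => (r.1.1, α * r.1.2 + β * r.2)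
  have hg : Measurable g := by fun_prop
  have hgauss : ∀ (x x' : ℝ) (f : ℝ × ℝ → ENNReal), Measurable f →
      ∫⁻ z, ∫⁻ w, f (x, α * (√s * x' + z) + β * w) ∂gaussianReal 0 1 ∂gaussianReal 0 1
        = ∫⁻ u, f (x, √s' * x' + u) ∂gaussianReal 0 1 := fun x x' f hf => by
    conv_rhs => rw [← gaussianReal_map_mul_add_mul hαβ]
    rw [lintegral_map (by fun_prop) (by fun_prop), lintegral_prod _ (by fun_prop)]
    refine lintegral_congr fun z => lintegral_congr fun w => ?_
    congr 2
    rw [← hαs]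
    ring
  have hjoint : ((awgnJoint p s).prod (gaussianReal 0 1)).map g = awgnJoint p s' := by
    refine Measure.ext_of_lintegral _ fun f hf => ?_
    rw [lintegral_map hf hg, lintegral_prod _ (by fun_prop),
      lintegral_awgnJoint s (f := fun q => ∫⁻ w, f (g (q, w)) ∂gaussianReal 0 1)
        (Measurable.lintegral_prod_right' (f := f ∘ g) (hf.comp hg)),
      lintegral_awgnJoint s' hf]
    exact lintegral_congr fun x => hgauss x x f hf
  have hprod : ((p.prod (awgnOutput p s)).prod (gaussianReal 0 1)).map g
      = p.prod (awgnOutput p s') := by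
    refine Measure.ext_of_lintegral _ fun f hf => ?_
    have hfg : Measurable fun q : ℝ × ℝ => ∫⁻ w, f (g (q, w)) ∂gaussianReal 0 1 :=
      Measurable.lintegral_prod_right' (f := f ∘ g) (hf.comp hg)
    rw [lintegral_map hf hg, lintegral_prod _ (by fun_prop), lintegral_prod _ hfg.aemeasurable,
      lintegral_prod _ hf.aemeasurable]
    refine lintegral_congr fun x => ?_
    rw [lintegral_awgnOutput s (f := fun y => ∫⁻ w, f (g ((x, y), w)) ∂gaussianReal 0 1)
        (hfg.comp measurable_prodMk_left),
      lintegral_awgnOutput s' (f := fun y => f (x, y)) (by fun_prop)]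
    exact lintegral_congr fun x' => hgauss x x' f hf
  rw [← hjoint, ← hprod]
  -- Data processing for `g`; adjoining the same independent noise to both measures does not change
  -- the divergence.
  refine (InformationTheory.klDiv_map_le _ _ hg).trans (le_of_eq ?_)
  rw [← Measure.compProd_const, ← Measure.compProd_const, InformationTheory.klDiv_compProd_left]

end Channel

/-! ### Mutual information and entropy of the discretized signal -/

/-- The probability of the cell `⌊t x⌋ = k`. -/
noncomputable def cellMass (p : Measure ℝ) (t : ℝ) (k : ℤ) : ℝ := p.real {x | ⌊t * x⌋ = k}

/-- The surprisal `- log P(⌊t x⌋ = k)` of a cell. -/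
noncomputable def surprisal (p : Measure ℝ) (t : ℝ) (k : ℤ) : ℝ := -Real.log (cellMass p t k)

/-- The entropy of `⌊t x⌋` as an extended nonnegative number. -/
noncomputable def cellEntropy (p : Measure ℝ) (t : ℝ) : ENNReal :=
  ∫⁻ x, ENNReal.ofReal (surprisal p t ⌊t * x⌋) ∂p

theorem measurable_floor_mul (t : ℝ) : Measurable fun x : ℝ => ⌊t * x⌋ :=
  Int.measurable_floor.comp (measurable_const.mul measurable_id)

theorem measurable_comp_floor_mul {β : Type*} [MeasurableSpace β] (t : ℝ) (F : ℤ → β) :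
    Measurable fun x : ℝ => F ⌊t * x⌋ :=
  (measurable_from_top (f := F)).comp (measurable_floor_mul t)

theorem tsum_exp_neg_abs_ne_top : ∑' k : ℤ, ENNReal.ofReal (Real.exp (-|(k : ℝ)|)) ≠ ⊤ := by
  have h : Summable fun k : ℤ => Real.exp (-|(k : ℝ)|) := by
    rw [summable_int_iff_summable_nat_and_neg]
    have h1 : Summable fun n : ℕ => Real.exp (-(n : ℝ)) := Real.summable_exp_neg_nat
    constructor <;> simpa using h1
  rw [← ENNReal.ofReal_tsum_of_nonneg (fun _ => (Real.exp_pos _).le) h]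
  exact ENNReal.ofReal_ne_top

/-- Shifting the index by `⌊y⌋` moves each exponent by at most one, which costs the factor `e` and
makes the bound uniform in `y`. -/
theorem tsum_exp_neg_abs_sub_le (y : ℝ) : ∑' k : ℤ, ENNReal.ofReal (Real.exp (-|(k : ℝ) - y|))
    ≤ ENNReal.ofReal (Real.exp 1) * ∑' k : ℤ, ENNReal.ofReal (Real.exp (-|(k : ℝ)|)) := by
  rw [← (Equiv.subRight ⌊y⌋).tsum_eq fun k : ℤ => ENNReal.ofReal (Real.exp (-|(k : ℝ)|)),
    ← ENNReal.tsum_mul_left]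
  refine ENNReal.tsum_le_tsum fun k => ?_
  rw [← ENNReal.ofReal_mul (Real.exp_pos _).le, ← Real.exp_add]
  refine ENNReal.ofReal_le_ofReal (Real.exp_le_exp.mpr ?_)
  rw [Equiv.subRight_apply, Int.cast_sub]
  have h1 : |y - ⌊y⌋| ≤ 1 := by
    rw [abs_of_nonneg (by linarith [Int.floor_le y])]
    linarith [Int.lt_floor_add_one y]
  have h2 : |(k : ℝ) - ⌊y⌋| ≤ |(k : ℝ) - y| + |y - ⌊y⌋| := by
    have : (k : ℝ) - ⌊y⌋ = (k - y) + (y - ⌊y⌋) := by ring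
    rw [this]
    exact abs_add_le _ _
  linarith

theorem lintegral_abs_gaussianReal_ne_top (c : ℝ) :
    ∫⁻ z, ENNReal.ofReal (|z| + c) ∂gaussianReal 0 1 ≠ ⊤ := by
  have h1 : Integrable (fun z : ℝ => z) (gaussianReal 0 1) :=
    (memLp_id_gaussianReal 1).integrable (by simp)
  exact (h1.abs.add (integrable_const c)).lintegral_lt_top.ne

section Entropy

variable {p : Measure ℝ} [IsProbabilityMeasure p]

theorem cellMass_nonneg {p : Measure ℝ} (t : ℝ) (k : ℤ) : 0 ≤ cellMass p t k := measureReal_nonneg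

theorem cellMass_le_one (t : ℝ) (k : ℤ) : cellMass p t k ≤ 1 := measureReal_le_one

theorem surprisal_nonneg (t : ℝ) (k : ℤ) : 0 ≤ surprisal p t k :=
  neg_nonneg.mpr (Real.log_nonpos (cellMass_nonneg t k) (cellMass_le_one t k))

theorem lintegral_comp_floor_mul (t : ℝ) (F : ℤ → ENNReal) :
    ∫⁻ x, F ⌊t * x⌋ ∂p = ∑' k, F k * ENNReal.ofReal (cellMass p t k) := by
  rw [← lintegral_map (f := F) measurable_from_top (measurable_floor_mul t), lintegral_countable']
  refine tsum_congr fun k => ?_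
  rw [Measure.map_apply (measurable_floor_mul t) (measurableSet_singleton k), cellMass,
    ofReal_measureReal]
  rfl

/-- There are only countably many null cells. They must be excluded because `Real.log 0 = 0` assigns
them surprisal zero. -/
theorem ae_cellMass_pos (t : ℝ) : ∀ᵐ x ∂p, 0 < cellMass p t ⌊t * x⌋ := by
  classical
  let F : ℤ → ENNReal := fun k => if cellMass p t k = 0 then 1 else 0
  have h : ∫⁻ x, F ⌊t * x⌋ ∂p = 0 := by
    rw [lintegral_comp_floor_mul, ENNReal.tsum_eq_zero]
    intro k
    by_cases hk : cellMass p t k = 0 <;> simp [F, hk]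
  rw [lintegral_eq_zero_iff (measurable_comp_floor_mul t F)] at h
  filter_upwards [h] with x hx
  refine lt_of_le_of_ne (cellMass_nonneg _ _) fun h0 => ?_
  simp [F, ← h0] at hx

theorem cellEntropy_eq_tsum (t : ℝ) :
    cellEntropy p t = ∑' k, ENNReal.ofReal (Real.negMulLog (cellMass p t k)) := by
  rw [cellEntropy, lintegral_comp_floor_mul t fun k => ENNReal.ofReal (surprisal p t k)]
  refine tsum_congr fun k => ?_
  rw [← ENNReal.ofReal_mul (surprisal_nonneg t k), surprisal, Real.negMulLog]
  congr 1
  ring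

theorem toReal_cellEntropy (n : ℕ) : (cellEntropy p n).toReal = discretizedEntropy p n := by
  rw [cellEntropy_eq_tsum, ENNReal.tsum_toReal_eq fun _ => ENNReal.ofReal_ne_top]
  refine tsum_congr fun k => ENNReal.toReal_ofReal ?_
  exact Real.negMulLog_nonneg (cellMass_nonneg _ _) (cellMass_le_one _ _)

/-- A Gibbs-type bound for a single term of the entropy. -/
theorem negMulLog_le_mul_add_exp {x : ℝ} (hx : 0 ≤ x) (c : ℝ) :
    Real.negMulLog x ≤ c * x + Real.exp (-c) := by
  rcases hx.eq_or_lt with rfl | hx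
  · simpa using (Real.exp_pos _).le
  -- The inequality `1 - 1 / y ≤ log y` at `y = x * exp c`.
  have h := Real.one_sub_inv_le_log_of_pos (mul_pos hx (Real.exp_pos c))
  rw [Real.log_mul hx.ne' (Real.exp_pos c).ne', Real.log_exp] at h
  have h2 := mul_le_mul_of_nonneg_left h hx.le
  have h3 : x * (1 - (x * Real.exp c)⁻¹) = x - Real.exp (-c) := by
    rw [Real.exp_neg]
    field_simp
  rw [Real.negMulLog]
  nlinarith

/-- A random variable with a finite first moment has finite discretized entropies. -/
theorem cellEntropy_ne_top (hint : Integrable (fun x : ℝ => x) p) (t : ℝ) :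
    cellEntropy p t ≠ ⊤ := by
  have h1 : ∫⁻ x, ENNReal.ofReal |(⌊t * x⌋ : ℝ)| ∂p ≠ ⊤ := by
    have h2 : Integrable (fun x : ℝ => |t * x| + 1) p :=
      (hint.const_mul t).abs.add (integrable_const 1)
    refine ne_top_of_le_ne_top h2.lintegral_lt_top.ne (lintegral_mono fun x => ?_)
    refine ENNReal.ofReal_le_ofReal ?_
    have h3 : |t * x - ⌊t * x⌋| ≤ 1 := by
      rw [abs_of_nonneg (by linarith [Int.floor_le (t * x)])]
      linarith [Int.lt_floor_add_one (t * x)]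
    have h4 : (⌊t * x⌋ : ℝ) = t * x - (t * x - ⌊t * x⌋) := by ring
    rw [h4]
    exact (abs_sub _ _).trans (by linarith)
  rw [lintegral_comp_floor_mul t fun k => ENNReal.ofReal |(k : ℝ)|] at h1
  rw [cellEntropy_eq_tsum]
  -- The Gibbs-type bound with `c = |k|` dominates the entropy by the first absolute moment of `⌊t
  -- x⌋` plus a convergent series.
  refine ne_top_of_le_ne_top (ENNReal.add_ne_top.mpr ⟨h1, tsum_exp_neg_abs_ne_top⟩) ?_
  rw [← ENNReal.tsum_add]
  refine ENNReal.tsum_le_tsum fun k => ?_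
  rw [← ENNReal.ofReal_mul (abs_nonneg _), ← ENNReal.ofReal_add
    (mul_nonneg (abs_nonneg _) (cellMass_nonneg _ _)) (Real.exp_pos _).le]
  exact ENNReal.ofReal_le_ofReal (negMulLog_le_mul_add_exp (cellMass_nonneg _ _) _)

/-- The output density is at least the contribution of the cell of any given input. -/
theorem cellMass_mul_le_outputDensity (s x y : ℝ) :
    cellMass p (√s) ⌊√s * x⌋
        * (gaussianPDFReal (√s * x) 1 y * Real.exp (-(|y - √s * x| + 1 / 2)))
      ≤ outputDensity p s y := by
  set c := gaussianPDFReal (√s * x) 1 y * Real.exp (-(|y - √s * x| + 1 / 2)) with hc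
  set T := {x' : ℝ | ⌊√s * x'⌋ = ⌊√s * x⌋} with hT
  have hTm : MeasurableSet T := measurable_floor_mul (√s) (measurableSet_singleton _)
  have h1 : ∫ x', T.indicator (fun _ => c) x' ∂p ≤ outputDensity p s y := by
    refine integral_mono ((integrable_const c).indicator hTm) (integrable_channelDensity s y)
      fun x' => ?_
    by_cases hx' : x' ∈ T
    · simp only [Set.indicator_of_mem hx']
      refine gaussianPDFReal_one_mul_exp_le ?_ y
      exact (Int.abs_sub_lt_one_of_floor_eq_floor (hx' : _ = _).symm).le
    · simp only [Set.indicator_of_notMem hx']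
      exact gaussianPDFReal_nonneg _ _ _
  rw [integral_indicator_const _ hTm, smul_eq_mul] at h1
  exact h1

/-- Keeping only the cell of the true input in the output density gives `log (a / b) ≤ surprisal +
|z| + 1 / 2`, where `z` is the noise. The final `1` is the total mass of the output density, from
the correction term. -/
theorem lintegral_infoIntegrand_le (s : ℝ) :
    ∫⁻ q, ENNReal.ofReal (infoIntegrand p s q) ∂(p.prod volume)
      ≤ cellEntropy p (√s) + ∫⁻ z, ENNReal.ofReal (|z| + 1 / 2) ∂gaussianReal 0 1 + 1 := by
  let U : ℝ × ℝ → ENNReal := fun q =>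
    ENNReal.ofReal (surprisal p (√s) ⌊√s * q.1⌋) + ENNReal.ofReal (|q.2 - √s * q.1| + 1 / 2)
  have hU1 : Measurable fun q : ℝ × ℝ => ENNReal.ofReal (surprisal p (√s) ⌊√s * q.1⌋) :=
    (measurable_comp_floor_mul (√s) fun k => ENNReal.ofReal (surprisal p (√s) k)).comp
      measurable_fst
  have hU : Measurable U := hU1.add (by fun_prop)
  have hae : ∀ᵐ q ∂(p.prod (volume : Measure ℝ)), 0 < cellMass p (√s) ⌊√s * q.1⌋ :=
    Measure.quasiMeasurePreserving_fst.ae (ae_cellMass_pos (√s))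
  have hle : ∫⁻ q, ENNReal.ofReal (infoIntegrand p s q) ∂(p.prod volume)
      ≤ ∫⁻ q, ENNReal.ofReal (gaussianPDFReal (√s * q.1) 1 q.2) * U q
        + ENNReal.ofReal (outputDensity p s q.2) * 1 ∂(p.prod volume) := by
    refine lintegral_mono_ae ?_
    filter_upwards [hae] with q hq
    have ha := gaussianPDFReal_one_pos (√s * q.1) q.2
    have hb := outputDensity_pos (p := p) s q.2
    have hh := surprisal_nonneg (p := p) (√s) ⌊√s * q.1⌋
    have habs : 0 ≤ |q.2 - √s * q.1| + 1 / 2 := by positivity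
    simp only [U]
    rw [mul_one, ← ENNReal.ofReal_add hh habs, ← ENNReal.ofReal_mul ha.le,
      ← ENNReal.ofReal_add (by positivity) hb.le]
    refine ENNReal.ofReal_le_ofReal ?_
    have hlog : Real.log (gaussianPDFReal (√s * q.1) 1 q.2 / outputDensity p s q.2)
        ≤ surprisal p (√s) ⌊√s * q.1⌋ + (|q.2 - √s * q.1| + 1 / 2) := by
      have h := Real.log_le_log (by positivity) (cellMass_mul_le_outputDensity (p := p) s q.1 q.2)
      rw [Real.log_mul hq.ne' (by positivity), Real.log_mul ha.ne' (Real.exp_pos _).ne',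
        Real.log_exp] at h
      rw [Real.log_div ha.ne' hb.ne', surprisal]
      linarith
    have := mul_le_mul_of_nonneg_left hlog ha.le
    rw [infoIntegrand]
    linarith
  refine hle.trans (le_of_eq ?_)
  have haU : Measurable fun q : ℝ × ℝ =>
      ENNReal.ofReal (gaussianPDFReal (√s * q.1) 1 q.2) * U q :=
    (measurable_channelDensity s).ennreal_ofReal.mul hU
  rw [lintegral_add_left haU,
    lintegral_channelDensity_mul s hU, lintegral_outputDensity_mul s measurable_const]
  simp only [U, add_sub_cancel_left, lintegral_const, measure_univ, mul_one]
  congr 1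
  have h1 : ∀ x : ℝ, ∫⁻ z, ENNReal.ofReal (surprisal p (√s) ⌊√s * x⌋)
      + ENNReal.ofReal (|z| + 1 / 2) ∂gaussianReal 0 1 = ENNReal.ofReal (surprisal p (√s) ⌊√s * x⌋)
      + ∫⁻ z, ENNReal.ofReal (|z| + 1 / 2) ∂gaussianReal 0 1 := fun x => by
    rw [lintegral_add_left measurable_const]
    simp
  simp only [h1]
  rw [lintegral_add_right _ measurable_const]
  simp [cellEntropy]

/-- The reverse bound is a Gibbs variational inequality with test function `h - r`, where `h` is the
surprisal and `r` the distance from the output to `⌊√s x⌋`. The mean of `r` is at most that of `|z|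
+ 1`. In the mean of `exp (h - r)` the factor `exp h` cancels the cell mass, leaving the series of
`exp (-|k - y|)`. -/
theorem cellEntropy_le (s : ℝ) :
    cellEntropy p (√s) ≤ ∫⁻ q, ENNReal.ofReal (infoIntegrand p s q) ∂(p.prod volume)
      + ∫⁻ z, ENNReal.ofReal (|z| + 1) ∂gaussianReal 0 1
      + ENNReal.ofReal (Real.exp 1) * ∑' k : ℤ, ENNReal.ofReal (Real.exp (-|(k : ℝ)|)) := by
  have hfloor : Measurable fun q : ℝ × ℝ => (⌊√s * q.1⌋ : ℝ) :=
    (measurable_comp_floor_mul (√s) fun k => (k : ℝ)).comp measurable_fst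
  have hsur : Measurable fun q : ℝ × ℝ => surprisal p (√s) ⌊√s * q.1⌋ :=
    (measurable_comp_floor_mul (√s) fun k => surprisal p (√s) k).comp measurable_fst
  let g : ℝ × ℝ → ENNReal := fun q => ENNReal.ofReal |(⌊√s * q.1⌋ : ℝ) - q.2|
  let e : ℝ × ℝ → ENNReal := fun q =>
    ENNReal.ofReal (Real.exp (surprisal p (√s) ⌊√s * q.1⌋ - |(⌊√s * q.1⌋ : ℝ) - q.2|))
  have hg : Measurable g := (hfloor.sub measurable_snd).abs.ennreal_ofReal
  have he : Measurable e := (hsur.sub (hfloor.sub measurable_snd).abs).exp.ennreal_ofReal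
  have hle : ∫⁻ q, ENNReal.ofReal (gaussianPDFReal (√s * q.1) 1 q.2)
        * ENNReal.ofReal (surprisal p (√s) ⌊√s * q.1⌋) ∂(p.prod volume)
      ≤ ∫⁻ q, ENNReal.ofReal (infoIntegrand p s q)
        + ENNReal.ofReal (gaussianPDFReal (√s * q.1) 1 q.2) * g q
        + ENNReal.ofReal (outputDensity p s q.2) * e q ∂(p.prod volume) := by
    refine lintegral_mono fun q => ?_
    simp only [g, e]
    have ha := gaussianPDFReal_one_pos (√s * q.1) q.2
    have hb := outputDensity_pos (p := p) s q.2
    rw [← ENNReal.ofReal_mul ha.le, ← ENNReal.ofReal_mul ha.le, ← ENNReal.ofReal_mul hb.le]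
    refine le_trans (ENNReal.ofReal_le_ofReal ?_)
      ((ENNReal.ofReal_add_le).trans (add_le_add_left ENNReal.ofReal_add_le _))
    rw [infoIntegrand]
    set a := gaussianPDFReal (√s * q.1) 1 q.2
    set b := outputDensity p s q.2
    set h := surprisal p (√s) ⌊√s * q.1⌋
    set r := |(⌊√s * q.1⌋ : ℝ) - q.2|
    -- The inequality `1 - 1 / y ≤ log y` at `y = a / (b * exp (h - r))`, multiplied by `a` below.
    have h1 := Real.one_sub_inv_le_log_of_pos (div_pos ha (mul_pos hb (Real.exp_pos (h - r))))
    rw [← div_div, Real.log_div (div_pos ha hb).ne' (Real.exp_pos _).ne', Real.log_exp] at h1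
    have h2 := mul_le_mul_of_nonneg_left h1 ha.le
    have h3 : a * (1 - (a / b / Real.exp (h - r))⁻¹) = a - b * Real.exp (h - r) := by
      field_simp
    rw [h3] at h2
    linarith
  have hgle : ∫⁻ q, ENNReal.ofReal (gaussianPDFReal (√s * q.1) 1 q.2) * g q ∂(p.prod volume)
      ≤ ∫⁻ z, ENNReal.ofReal (|z| + 1) ∂gaussianReal 0 1 := by
    rw [lintegral_channelDensity_mul s hg]
    have h1 : ∀ x : ℝ, ∫⁻ z, g (x, √s * x + z) ∂gaussianReal 0 1
        ≤ ∫⁻ z, ENNReal.ofReal (|z| + 1) ∂gaussianReal 0 1 := fun x => by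
      refine lintegral_mono fun z => ENNReal.ofReal_le_ofReal ?_
      have h3 : |√s * x - ⌊√s * x⌋| ≤ 1 := by
        rw [abs_of_nonneg (by linarith [Int.floor_le (√s * x)])]
        linarith [Int.lt_floor_add_one (√s * x)]
      have h4 : (⌊√s * x⌋ : ℝ) - (√s * x + z) = -z - (√s * x - ⌊√s * x⌋) := by ring
      simp only [h4]
      refine (abs_sub _ _).trans ?_
      rw [abs_neg]
      linarith
    exact (lintegral_mono h1).trans (by simp)
  have hele : ∫⁻ q, ENNReal.ofReal (outputDensity p s q.2) * e q ∂(p.prod volume)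
      ≤ ENNReal.ofReal (Real.exp 1) * ∑' k : ℤ, ENNReal.ofReal (Real.exp (-|(k : ℝ)|)) := by
    rw [lintegral_outputDensity_mul s he, lintegral_prod_symm _ he.aemeasurable]
    have h1 : ∀ y : ℝ, ∫⁻ x, e (x, y) ∂p
        ≤ ENNReal.ofReal (Real.exp 1) * ∑' k : ℤ, ENNReal.ofReal (Real.exp (-|(k : ℝ)|)) :=
      fun y => by
        refine le_trans ?_ (tsum_exp_neg_abs_sub_le y)
        simp only [e]
        rw [lintegral_comp_floor_mul (√s) fun k =>
          ENNReal.ofReal (Real.exp (surprisal p (√s) k - |(k : ℝ) - y|))]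
        refine ENNReal.tsum_le_tsum fun k => ?_
        rw [← ENNReal.ofReal_mul (Real.exp_pos _).le]
        refine ENNReal.ofReal_le_ofReal ?_
        -- On a null cell the surprisal is a default value, but the factor `cellMass` removes the
        -- term.
        rcases (cellMass_nonneg (p := p) (√s) k).eq_or_lt with h0 | h0
        · rw [← h0, mul_zero]
          exact (Real.exp_pos _).le
        · rw [sub_eq_add_neg, Real.exp_add, surprisal, Real.exp_neg, Real.exp_log h0]
          exact le_of_eq (by field_simp)
    exact (lintegral_mono h1).trans (by simp)
  have hl : ∫⁻ q, ENNReal.ofReal (gaussianPDFReal (√s * q.1) 1 q.2)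
      * ENNReal.ofReal (surprisal p (√s) ⌊√s * q.1⌋) ∂(p.prod volume) = cellEntropy p (√s) := by
    rw [lintegral_channelDensity_mul s hsur.ennreal_ofReal]
    simp [cellEntropy]
  rw [← hl]
  refine hle.trans ?_
  have hag : Measurable fun q : ℝ × ℝ =>
      ENNReal.ofReal (gaussianPDFReal (√s * q.1) 1 q.2) * g q :=
    (measurable_channelDensity s).ennreal_ofReal.mul hg
  have hbe : Measurable fun q : ℝ × ℝ => ENNReal.ofReal (outputDensity p s q.2) * e q :=
    (measurable_outputDensity_snd s).ennreal_ofReal.mul he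
  rw [lintegral_add_right _ hbe, lintegral_add_right _ hag]
  exact add_le_add (add_le_add_right hgle _) hele

/-! ### Properties of the mutual information -/

theorem lintegral_infoIntegrand_ne_top (hint : Integrable (fun x : ℝ => x) p) (s : ℝ) :
    ∫⁻ q, ENNReal.ofReal (infoIntegrand p s q) ∂(p.prod volume) ≠ ⊤ :=
  ne_top_of_le_ne_top (ENNReal.add_ne_top.mpr ⟨ENNReal.add_ne_top.mpr
    ⟨cellEntropy_ne_top hint _, lintegral_abs_gaussianReal_ne_top _⟩, ENNReal.one_ne_top⟩)
    (lintegral_infoIntegrand_le s)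

theorem mutualInfo_mono (hint : Integrable (fun x : ℝ => x) p) {s s' : ℝ} (hs' : 0 ≤ s')
    (hss : s' ≤ s) : mutualInfo p s' ≤ mutualInfo p s := by
  rw [mutualInfo_eq, mutualInfo_eq]
  refine ENNReal.toReal_mono (lintegral_infoIntegrand_ne_top hint s) ?_
  rw [← klDiv_awgnJoint, ← klDiv_awgnJoint]
  exact klDiv_awgnJoint_mono hs' hss

theorem lowerSemicontinuous_mutualInfo (hint : Integrable (fun x : ℝ => x) p) :
    LowerSemicontinuous (mutualInfo p) := by
  intro s y hy
  rcases lt_or_ge y 0 with h0 | h0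
  · exact Eventually.of_forall fun s' => h0.trans_le ENNReal.toReal_nonneg
  rw [gt_iff_lt, mutualInfo_eq, ← ENNReal.ofReal_lt_iff_lt_toReal h0
    (lintegral_infoIntegrand_ne_top hint s)] at hy
  filter_upwards [lowerSemicontinuous_lintegral_infoIntegrand s _ hy] with s' hs'
  rwa [gt_iff_lt, mutualInfo_eq, ← ENNReal.ofReal_lt_iff_lt_toReal h0
    (lintegral_infoIntegrand_ne_top hint s')]

/-- At signal-to-noise ratio `n ^ 2` the mutual information is the entropy of the discretization
at scale `1 / n` up to a bounded error. -/
theorem exists_abs_mutualInfo_sub_discretizedEntropy_le (hint : Integrable (fun x : ℝ => x) p) :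
    ∃ C : ℝ, ∀ n : ℕ, |mutualInfo p ((n : ℝ) ^ 2) - discretizedEntropy p n| ≤ C := by
  set c₁ := ∫⁻ z, ENNReal.ofReal (|z| + 1 / 2) ∂gaussianReal 0 1
  set c₂ := ∫⁻ z, ENNReal.ofReal (|z| + 1) ∂gaussianReal 0 1
  set c₃ := ENNReal.ofReal (Real.exp 1) * ∑' k : ℤ, ENNReal.ofReal (Real.exp (-|(k : ℝ)|))
  have hc₁ : c₁ ≠ ⊤ := lintegral_abs_gaussianReal_ne_top _
  have hc₂ : c₂ ≠ ⊤ := lintegral_abs_gaussianReal_ne_top _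
  have hc₃ : c₃ ≠ ⊤ := ENNReal.mul_ne_top ENNReal.ofReal_ne_top tsum_exp_neg_abs_ne_top
  refine ⟨max (c₁.toReal + 1) (c₂.toReal + c₃.toReal), fun n => ?_⟩
  have hH := cellEntropy_ne_top hint (n : ℝ)
  have hD := lintegral_infoIntegrand_ne_top hint ((n : ℝ) ^ 2)
  have h1 := lintegral_infoIntegrand_le (p := p) ((n : ℝ) ^ 2)
  have h2 := cellEntropy_le (p := p) ((n : ℝ) ^ 2)
  rw [Real.sqrt_sq n.cast_nonneg] at h1 h2
  replace h1 := ENNReal.toReal_mono (by finiteness) h1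
  replace h2 := ENNReal.toReal_mono (by finiteness) h2
  rw [ENNReal.toReal_add (by finiteness) (by finiteness),
    ENNReal.toReal_add (by finiteness) (by finiteness), toReal_cellEntropy, ← mutualInfo_eq,
    ENNReal.toReal_one] at h1
  rw [ENNReal.toReal_add (by finiteness) (by finiteness),
    ENNReal.toReal_add (by finiteness) (by finiteness), toReal_cellEntropy, ← mutualInfo_eq] at h2
  rw [abs_le]
  constructor
  · linarith [le_max_right (c₁.toReal + 1) (c₂.toReal + c₃.toReal)]
  · linarith [le_max_left (c₁.toReal + 1) (c₂.toReal + c₃.toReal)]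

/-- The mutual information grows like `d / 2 * log s`, where `d` is the information dimension. -/
theorem tendsto_mutualInfo_div_log (hint : Integrable (fun x : ℝ => x) p) {d : ℝ}
    (hd : HasInformationDimension p d) :
    Tendsto (fun s => mutualInfo p s / Real.log s) atTop (𝓝 (d / 2)) := by
  have hlog : Tendsto (fun n : ℕ => Real.log n) atTop atTop :=
    Real.tendsto_log_atTop.comp tendsto_natCast_atTop_atTop
  obtain ⟨C, hC⟩ := exists_abs_mutualInfo_sub_discretizedEntropy_le hint
  have hu : Tendsto (fun n : ℕ => mutualInfo p ((n : ℝ) ^ 2) / Real.log n) atTop (𝓝 d) := by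
    have h0 : Tendsto (fun n : ℕ => (mutualInfo p ((n : ℝ) ^ 2) - discretizedEntropy p n)
        / Real.log n) atTop (𝓝 0) := by
      refine squeeze_zero_norm' ?_ (hlog.const_div_atTop C)
      filter_upwards [hlog.eventually_gt_atTop 0] with n hn
      rw [norm_div, Real.norm_of_nonneg hn.le]
      exact div_le_div_of_nonneg_right (hC n) hn.le
    have h1 := h0.add hd
    rw [zero_add] at h1
    refine h1.congr fun n => ?_
    ring
  -- A real `s` is sandwiched between `n ^ 2` and `(n + 1) ^ 2` with `n = ⌊√s⌋₊`; by this ratio both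
  -- monotonicity bounds have the same limit.
  have hratio : Tendsto (fun n : ℕ => Real.log (n + 1) / Real.log n) atTop (𝓝 1) := by
    have h0 := (Real.tendsto_log_nat_add_one_sub_log.div_atTop hlog).add_const 1
    rw [zero_add] at h0
    refine h0.congr' ?_
    filter_upwards [hlog.eventually_gt_atTop 0] with n hn
    field_simp
    ring
  have hlow : Tendsto (fun n : ℕ => mutualInfo p ((n : ℝ) ^ 2) / (2 * Real.log (n + 1))) atTop
      (𝓝 (d / 2)) := by
    have h0 := (hu.div hratio one_ne_zero).div_const 2
    rw [div_one] at h0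
    refine h0.congr' ?_
    filter_upwards [hlog.eventually_gt_atTop 0] with n hn
    simp only [Pi.div_apply]
    field_simp
  have hupp : Tendsto (fun n : ℕ => mutualInfo p (((n + 1 : ℕ) : ℝ) ^ 2) / (2 * Real.log n)) atTop
      (𝓝 (d / 2)) := by
    have h0 := ((hu.comp (tendsto_add_atTop_nat 1)).mul hratio).div_const 2
    rw [mul_one] at h0
    refine h0.congr' ?_
    filter_upwards [hlog.eventually_gt_atTop 0] with n hn
    have hn' : Real.log ((n : ℝ) + 1) ≠ 0 := by
      rcases Nat.eq_zero_or_pos n with rfl | h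
      · simp at hn
      · have : (0 : ℝ) < n := by exact_mod_cast h
        exact (hn.trans (Real.log_lt_log this (lt_add_one _))).ne'
    simp only [Function.comp, Nat.cast_add, Nat.cast_one]
    field_simp
  have hfloor : Tendsto (fun s : ℝ => ⌊√s⌋₊) atTop atTop :=
    tendsto_nat_floor_atTop.comp Real.tendsto_sqrt_atTop
  -- For `s ≥ 4` the floor of `√s` is at least two, so the logarithms in the denominators are
  -- positive.
  have hbound : ∀ᶠ s : ℝ in atTop, 4 ≤ s := eventually_ge_atTop 4
  have hfacts : ∀ s : ℝ, 4 ≤ s → 2 ≤ (⌊√s⌋₊ : ℝ) ∧ (⌊√s⌋₊ : ℝ) ^ 2 ≤ s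
      ∧ s ≤ ((⌊√s⌋₊ : ℝ) + 1) ^ 2 := fun s hs => by
    have hs0 : 0 ≤ s := by linarith
    have h2 : (2 : ℝ) ≤ √s := Real.le_sqrt_of_sq_le (by linarith)
    refine ⟨by exact_mod_cast Nat.le_floor (by exact_mod_cast h2), ?_, ?_⟩
    · calc (⌊√s⌋₊ : ℝ) ^ 2 ≤ (√s) ^ 2 :=
            pow_le_pow_left₀ (Nat.cast_nonneg _) (Nat.floor_le (Real.sqrt_nonneg s)) 2
        _ = s := Real.sq_sqrt hs0
    · calc s = (√s) ^ 2 := (Real.sq_sqrt hs0).symm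
        _ ≤ _ := pow_le_pow_left₀ (Real.sqrt_nonneg s) (Nat.lt_floor_add_one _).le 2
  refine tendsto_of_tendsto_of_tendsto_of_le_of_le' (hlow.comp hfloor) (hupp.comp hfloor) ?_ ?_
  · filter_upwards [hbound] with s hs
    obtain ⟨h1, h2, h3⟩ := hfacts s hs
    refine div_le_div₀ ENNReal.toReal_nonneg (mutualInfo_mono hint (sq_nonneg _) h2)
      (Real.log_pos (by linarith)) ?_
    have := Real.log_le_log (by linarith) h3
    rwa [Real.log_pow, Nat.cast_ofNat] at this
  · filter_upwards [hbound] with s hs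
    obtain ⟨h1, h2, h3⟩ := hfacts s hs
    refine div_le_div₀ ENNReal.toReal_nonneg (mutualInfo_mono hint (by linarith) ?_)
      (mul_pos two_pos (Real.log_pos (by linarith))) ?_
    · simpa using h3
    · have := Real.log_le_log (by positivity) h2
      rwa [Real.log_pow, Nat.cast_ofNat] at this

end Entropy

/-! ### The integrated R-transform -/

section Integral

variable {ν : Measure ℝ} [IsProbabilityMeasure ν]

theorem integral_rTransform_sub (hpos : ∀ᵐ x ∂ν, 0 ≤ x) (hint : Integrable (fun x : ℝ => x) ν)
    (htop : Tendsto (fun z => z * etaTransform ν z) atTop atTop) {a b : ℝ} (ha : 0 ≤ a)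
    (hb : 0 ≤ b) : (∫ z in (0 : ℝ)..b, rTransform ν (-z)) - ∫ z in (0 : ℝ)..a, rTransform ν (-z)
      = ∫ z in a..b, rTransform ν (-z) :=
  intervalIntegral.integral_interval_sub_left
    (intervalIntegrable_rTransform_neg hpos hint htop le_rfl hb)
    (intervalIntegrable_rTransform_neg hpos hint htop le_rfl ha)

theorem integral_rTransform_mono (hpos : ∀ᵐ x ∂ν, 0 ≤ x) (hint : Integrable (fun x : ℝ => x) ν)
    (htop : Tendsto (fun z => z * etaTransform ν z) atTop atTop) {a b : ℝ} (ha : 0 ≤ a)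
    (hab : a ≤ b) :
    ∫ z in (0 : ℝ)..a, rTransform ν (-z) ≤ ∫ z in (0 : ℝ)..b, rTransform ν (-z) := by
  rw [← sub_nonneg, integral_rTransform_sub hpos hint htop ha (ha.trans hab),
    intervalIntegral.integral_of_le hab]
  exact setIntegral_nonneg measurableSet_Ioc fun z hz =>
    rTransform_neg_nonneg hpos htop (ha.trans_lt hz.1)

theorem integral_rTransform_nonneg (hpos : ∀ᵐ x ∂ν, 0 ≤ x) (hint : Integrable (fun x : ℝ => x) ν)
    (htop : Tendsto (fun z => z * etaTransform ν z) atTop atTop) {b : ℝ} (hb : 0 ≤ b) :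
    0 ≤ ∫ z in (0 : ℝ)..b, rTransform ν (-z) := by
  simpa using integral_rTransform_mono hpos hint htop le_rfl hb

theorem integral_rTransform_le (hpos : ∀ᵐ x ∂ν, 0 ≤ x) (hint : Integrable (fun x : ℝ => x) ν)
    (htop : Tendsto (fun z => z * etaTransform ν z) atTop atTop) {b : ℝ} (hb : 0 ≤ b) :
    ∫ z in (0 : ℝ)..b, rTransform ν (-z) ≤ b * ∫ x, x ∂ν := by
  have h := intervalIntegral.integral_mono_on_of_le_Ioo hb
    (intervalIntegrable_rTransform_neg hpos hint htop le_rfl hb)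
    (intervalIntegrable_const (c := ∫ x, x ∂ν))
    fun z hz => rTransform_neg_le_mean hpos hint htop hz.1
  simpa using h

theorem intervalIntegrable_const_mul_inv {a b c : ℝ} (ha : 0 < a) (hab : a ≤ b) :
    IntervalIntegrable (fun z => c * z⁻¹) volume a b := by
  refine (intervalIntegral.intervalIntegrable_inv (fun z hz => ?_) continuousOn_id).const_mul c
  rw [Set.uIcc_of_le hab] at hz
  exact (ha.trans_le hz.1).ne'

theorem integral_rTransform_sub_le_log (hpos : ∀ᵐ x ∂ν, 0 ≤ x)
    (hint : Integrable (fun x : ℝ => x) ν)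
    (htop : Tendsto (fun z => z * etaTransform ν z) atTop atTop) {a b : ℝ} (ha : 0 < a)
    (hab : a ≤ b) :
    (∫ z in (0 : ℝ)..b, rTransform ν (-z)) - ∫ z in (0 : ℝ)..a, rTransform ν (-z)
      ≤ (1 - ν.real {0}) * Real.log (b / a) := by
  have hb := ha.trans_le hab
  rw [integral_rTransform_sub hpos hint htop ha.le hb.le, ← integral_inv_of_pos ha hb,
    ← intervalIntegral.integral_const_mul]
  refine intervalIntegral.integral_mono_on hab
    (intervalIntegrable_rTransform_neg hpos hint htop ha.le hb.le)
    (intervalIntegrable_const_mul_inv ha hab) fun z hz => ?_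
  have hz0 := ha.trans_le hz.1
  rw [← div_eq_mul_inv, le_div_iff₀ hz0, mul_comm]
  exact mul_rTransform_neg_le hpos htop hz0

/-- Beyond some `w` the integrand exceeds `c' / z` with `c < c'`; the slack `(c' - c) log x` absorbs
the constant `c' log w`. -/
theorem eventually_mul_log_le_integral_rTransform (hpos : ∀ᵐ x ∂ν, 0 ≤ x)
    (hint : Integrable (fun x : ℝ => x) ν)
    (htop : Tendsto (fun z => z * etaTransform ν z) atTop atTop) {c : ℝ}
    (hc : c < 1 - ν.real {0}) :
    ∀ᶠ x in atTop, c * Real.log x ≤ ∫ z in (0 : ℝ)..x, rTransform ν (-z) := by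
  obtain ⟨c', hcc', hc'⟩ := exists_between hc
  obtain ⟨u, hu⟩ := eventually_atTop.mp
    ((tendsto_mul_rTransform_neg hpos htop).eventually_const_lt hc')
  set w := max u 1 with hw
  have hw0 : 0 < w := one_pos.trans_le (le_max_right _ _)
  have hlog : Tendsto (fun x => (c' - c) * Real.log x) atTop atTop :=
    Real.tendsto_log_atTop.const_mul_atTop (sub_pos.mpr hcc')
  filter_upwards [eventually_ge_atTop w, hlog.eventually_ge_atTop (c' * Real.log w)] with x hx hx'
  have hx0 := hw0.trans_le hx
  have h1 : c' * Real.log (x / w) ≤ ∫ z in w..x, rTransform ν (-z) := by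
    rw [← integral_inv_of_pos hw0 hx0, ← intervalIntegral.integral_const_mul]
    refine intervalIntegral.integral_mono_on hx (intervalIntegrable_const_mul_inv hw0 hx)
      (intervalIntegrable_rTransform_neg hpos hint htop hw0.le hx0.le) fun z hz => ?_
    have hz0 := hw0.trans_le hz.1
    rw [← div_eq_mul_inv, div_le_iff₀ hz0, mul_comm]
    exact (hu z ((le_max_left _ _).trans hz.1)).le
  rw [← integral_rTransform_sub hpos hint htop hw0.le hx0.le,
    Real.log_div hx0.ne' hw0.ne'] at h1
  have h2 := integral_rTransform_nonneg hpos hint htop hw0.le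
  linarith

theorem continuousOn_integral_rTransform (hpos : ∀ᵐ x ∂ν, 0 ≤ x)
    (hint : Integrable (fun x : ℝ => x) ν)
    (htop : Tendsto (fun z => z * etaTransform ν z) atTop atTop) {b : ℝ} (hb : 0 ≤ b) :
    ContinuousOn (fun x => ∫ z in (0 : ℝ)..x, rTransform ν (-z)) (Set.Icc 0 b) := by
  have h := intervalIntegral.continuousOn_primitive_interval
    (μ := volume) (f := fun z => rTransform ν (-z)) (a := 0) (b := b) ?_
  · rwa [Set.uIcc_of_le hb] at h
  · rw [Set.uIcc_of_le hb, integrableOn_Icc_iff_integrableOn_Ioc,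
      ← intervalIntegrable_iff_integrableOn_Ioc_of_le hb]
    exact intervalIntegrable_rTransform_neg hpos hint htop le_rfl hb

end Integral

/-! ### Optimizers of the replica-symmetric potential -/

section Optimizer

variable {ν p : Measure ℝ} [IsProbabilityMeasure ν]

theorem rsPotential_le (hpos : ∀ᵐ x ∂ν, 0 ≤ x) (hint : Integrable (fun x : ℝ => x) ν)
    (htop : Tendsto (fun z => z * etaTransform ν z) atTop atTop) {v E s : ℝ} (hv : 0 < v)
    (hE : E ∈ Set.Icc (0 : ℝ) 1) (hs : 0 ≤ s) :
    rsPotential ν p v E s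
      ≤ mutualInfo p s + 1 / 2 * ∫ z in (0 : ℝ)..(1 / v), rTransform ν (-z) := by
  have h := integral_rTransform_mono hpos hint htop (div_nonneg hE.1 hv.le)
    (div_le_div_of_nonneg_right hE.2 hv.le)
  have := mul_nonneg hs hE.1
  rw [rsPotential]
  linarith

theorem bddAbove_rsPotential (hpos : ∀ᵐ x ∂ν, 0 ≤ x) (hint : Integrable (fun x : ℝ => x) ν)
    (htop : Tendsto (fun z => z * etaTransform ν z) atTop atTop) {v s : ℝ} (hv : 0 < v)
    (hs : 0 ≤ s) :
    BddAbove (Set.range fun E : Set.Icc (0 : ℝ) 1 => rsPotential ν p v E s) := by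
  refine ⟨mutualInfo p s + 1 / 2 * ∫ z in (0 : ℝ)..(1 / v), rTransform ν (-z), ?_⟩
  rintro _ ⟨E, rfl⟩
  exact rsPotential_le hpos hint htop hv E.2 hs

/-- For such `s` the penalty `s E` outweighs the linear bound on the integrated R-transform, so the
inner supremum is attained at `E = 0`. -/
theorem rsPotential_le_mutualInfo (hpos : ∀ᵐ x ∂ν, 0 ≤ x) (hint : Integrable (fun x : ℝ => x) ν)
    (htop : Tendsto (fun z => z * etaTransform ν z) atTop atTop) {v E s : ℝ} (hv : 0 < v)
    (hE : E ∈ Set.Icc (0 : ℝ) 1) (hs : (∫ x, x ∂ν) / v ≤ s) :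
    rsPotential ν p v E s ≤ mutualInfo p s := by
  have h := integral_rTransform_le hpos hint htop (div_nonneg hE.1 hv.le)
  have h1 : E / v * ∫ x, x ∂ν = (∫ x, x ∂ν) / v * E := by ring
  have h2 := mul_le_mul_of_nonneg_right hs hE.1
  rw [rsPotential]
  linarith

theorem rsPotential_zero {ν p : Measure ℝ} (v s : ℝ) : rsPotential ν p v 0 s = mutualInfo p s := by
  simp [rsPotential]

/-- The form in which optimality is tested: a rival `s'` supplies an upper bound for the minimax
value, a trial `E'` a lower bound. -/
theorem IsOptimizer.rsPotential_le (hpos : ∀ᵐ x ∂ν, 0 ≤ x) (hint : Integrable (fun x : ℝ => x) ν)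
    (htop : Tendsto (fun z => z * etaTransform ν z) atTop atTop) {v E s E' s' B : ℝ}
    (h : IsOptimizer ν p v E s) (hv : 0 < v) (hs' : 0 ≤ s')
    (hB : ∀ E' ∈ Set.Icc (0 : ℝ) 1, rsPotential ν p v E' s' ≤ B) (hE' : E' ∈ Set.Icc (0 : ℝ) 1) :
    rsPotential ν p v E' s ≤ B := by
  have h1 := le_ciSup (bddAbove_rsPotential (p := p) hpos hint htop hv h.2.1) ⟨E', hE'⟩
  have h2 : (⨆ E : Set.Icc (0 : ℝ) 1, rsPotential ν p v E s)
      ≤ ⨆ E : Set.Icc (0 : ℝ) 1, rsPotential ν p v E s' := h.2.2.2 hs'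
  have : Nonempty (Set.Icc (0 : ℝ) 1) := ⟨⟨E', hE'⟩⟩
  have h3 : (⨆ E : Set.Icc (0 : ℝ) 1, rsPotential ν p v E s') ≤ B :=
    ciSup_le fun E => hB E E.2
  exact h1.trans (h2.trans h3)

/-- The outer objective is a supremum of lower semicontinuous functions of `s`, so it has a minimum
on `[0, c]`. From `c` on it equals the mutual information, which is nondecreasing, so this minimum
is global. -/
theorem exists_isOptimizer (hpos : ∀ᵐ x ∂ν, 0 ≤ x) (hint : Integrable (fun x : ℝ => x) ν)
    (htop : Tendsto (fun z => z * etaTransform ν z) atTop atTop)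
    [IsProbabilityMeasure p] (hp : Integrable (fun x : ℝ => x) p) {v : ℝ} (hv : 0 < v) :
    ∃ E s : ℝ, IsOptimizer ν p v E s := by
  set c := (∫ x, x ∂ν) / v with hc
  have hc0 : 0 ≤ c := div_nonneg (integral_nonneg_of_ae hpos) hv.le
  have hne : Nonempty (Set.Icc (0 : ℝ) 1) := ⟨⟨0, by simp⟩⟩
  have hlsc : LowerSemicontinuousOn
      (fun s => ⨆ E : Set.Icc (0 : ℝ) 1, rsPotential ν p v E s) (Set.Icc 0 c) := by
    refine lowerSemicontinuousOn_ciSup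
      (fun s hs => bddAbove_rsPotential hpos hint htop hv hs.1) fun E => ?_
    have h1 : Continuous fun s : ℝ =>
        1 / 2 * (∫ z in (0 : ℝ)..(E / v), rTransform ν (-z)) - s * E / 2 := by fun_prop
    have h2 := ((lowerSemicontinuous_mutualInfo hp).add h1.lowerSemicontinuous)
    refine LowerSemicontinuous.lowerSemicontinuousOn ?_ _
    convert h2 using 2 with s
    rw [rsPotential]
    ring
  obtain ⟨s, hs, hmin⟩ := hlsc.exists_isMinOn ⟨0, by simpa using hc0⟩ isCompact_Icc
  have hcont : ContinuousOn (fun E => rsPotential ν p v E s) (Set.Icc 0 1) := by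
    have h1 : ContinuousOn (fun E => ∫ z in (0 : ℝ)..(E / v), rTransform ν (-z))
        (Set.Icc 0 1) :=
      (continuousOn_integral_rTransform hpos hint htop (one_div_nonneg.mpr hv.le)).comp
        (by fun_prop) fun E hE =>
          ⟨div_nonneg hE.1 hv.le, div_le_div_of_nonneg_right hE.2 hv.le⟩
    unfold rsPotential
    fun_prop
  obtain ⟨E, hE, hmax⟩ := isCompact_Icc.exists_isMaxOn ⟨0, by simp⟩ hcont
  refine ⟨E, s, hE, hs.1, hmax, fun s' hs' => ?_⟩
  rcases le_total s' c with h | h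
  · exact hmin ⟨hs', h⟩
  · have h1 : (⨆ E : Set.Icc (0 : ℝ) 1, rsPotential ν p v E s)
        ≤ ⨆ E : Set.Icc (0 : ℝ) 1, rsPotential ν p v E c := hmin ⟨hc0, le_rfl⟩
    refine h1.trans ?_
    calc (⨆ E : Set.Icc (0 : ℝ) 1, rsPotential ν p v E c)
        ≤ mutualInfo p c :=
          ciSup_le fun E => rsPotential_le_mutualInfo hpos hint htop hv E.2 le_rfl
      _ ≤ mutualInfo p s' := mutualInfo_mono hp hc0 h
      _ = rsPotential ν p v 0 s' := (rsPotential_zero v s').symm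
      _ ≤ _ := le_ciSup (bddAbove_rsPotential (p := p) hpos hint htop hv hs') ⟨0, by simp⟩

/-- At an optimizer the product `s E` is bounded, uniformly in the noise variance. -/
theorem IsOptimizer.mul_le (hpos : ∀ᵐ x ∂ν, 0 ≤ x) (hint : Integrable (fun x : ℝ => x) ν)
    (htop : Tendsto (fun z => z * etaTransform ν z) atTop atTop) {v E s : ℝ}
    (h : IsOptimizer ν p v E s) (hv : 0 < v) : s * E ≤ 2 * Real.log 2 := by
  have hlog2 : 0 < Real.log 2 := Real.log_pos one_lt_two
  rcases h.1.1.eq_or_lt with h0 | h0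
  · rw [← h0, mul_zero]
    positivity
  -- Passing from `E / 2` to `E` gains at most `(log 2) / 2` from the integral and loses `s E / 4`;
  -- the mutual information cancels.
  have h1 : rsPotential ν p v (E / 2) s ≤ rsPotential ν p v E s :=
    h.2.2.1 ⟨by linarith, by linarith [h.1.2]⟩
  have h2 := integral_rTransform_sub_le_log hpos hint htop (a := E / 2 / v) (b := E / v)
    (by positivity) (div_le_div_of_nonneg_right (by linarith) hv.le)
  have h3 : E / v / (E / 2 / v) = 2 := by field_simp
  rw [h3] at h2
  have h4 : (1 - ν.real {0}) * Real.log 2 ≤ Real.log 2 :=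
    mul_le_of_le_one_left hlog2.le (by linarith [measureReal_nonneg (μ := ν) (s := {0})])
  simp only [rsPotential] at h1
  linarith

/-- Below the threshold the signal-to-noise ratio of the optimizers diverges. -/
theorem eventually_le_of_isOptimizer (hpos : ∀ᵐ x ∂ν, 0 ≤ x)
    (hint : Integrable (fun x : ℝ => x) ν)
    (htop : Tendsto (fun z => z * etaTransform ν z) atTop atTop)
    [IsProbabilityMeasure p] (hp : Integrable (fun x : ℝ => x) p) {d : ℝ} (hd : HasInformationDimension p d)
    (hdδ : d < 1 - ν.real {0}) (K : ℝ) :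
    ∀ᶠ v in 𝓝[>] (0 : ℝ), ∀ E s : ℝ, IsOptimizer ν p v E s → K ≤ s := by
  obtain ⟨d₁, hd₁, hd₁δ⟩ := exists_between hdδ
  obtain ⟨d₂, hd₂, hd₂δ⟩ := exists_between hd₁δ
  have hm : 0 ≤ ∫ x, x ∂ν := integral_nonneg_of_ae hpos
  -- Any positive constant at least the mean works here.
  set c := (∫ x, x ∂ν) + 1 with hc
  have hc0 : 0 < c := by linarith
  have hinv : Tendsto (fun v : ℝ => 1 / v) (𝓝[>] 0) atTop := by
    simpa using tendsto_inv_nhdsGT_zero (𝕜 := ℝ)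
  have hcinv : Tendsto (fun v : ℝ => c / v) (𝓝[>] 0) atTop := by
    simpa [div_eq_mul_inv] using (tendsto_inv_nhdsGT_zero (𝕜 := ℝ)).const_mul_atTop hc0
  have hI : ∀ᶠ s in atTop, mutualInfo p s ≤ d₁ / 2 * Real.log s := by
    filter_upwards [(tendsto_mutualInfo_div_log hp hd).eventually_lt_const
      (by linarith : d / 2 < d₁ / 2), eventually_gt_atTop 1] with s hs hs1
    exact ((div_lt_iff₀ (Real.log_pos hs1)).mp hs).le
  have hG := eventually_mul_log_le_integral_rTransform hpos hint htop hd₂δ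
  have hlog : Tendsto (fun v : ℝ => (d₂ - d₁) * Real.log (1 / v)) (𝓝[>] 0) atTop :=
    (Real.tendsto_log_atTop.comp hinv).const_mul_atTop (sub_pos.mpr hd₂)
  filter_upwards [hcinv.eventually hI, hinv.eventually hG,
    hlog.eventually_gt_atTop (d₁ * Real.log c + K), self_mem_nhdsWithin] with v h1 h2 h3 hv E s h
  have hv0 : (0 : ℝ) < v := hv
  by_contra! hsK
  -- Trial `E' = 1` against the rival `c / v`, whose slice is bounded by its mutual information.
  -- With `s < K` this forces `(d₂ - d₁) log (1 / v) ≤ d₁ log c + K`.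
  have h4 : rsPotential ν p v 1 s ≤ mutualInfo p (c / v) :=
    h.rsPotential_le hpos hint htop hv0 (div_pos hc0 hv0).le
      (fun E' hE' => rsPotential_le_mutualInfo hpos hint htop hv0 hE'
        (div_le_div_of_nonneg_right (by linarith) hv0.le)) (by simp)
  have h5 : 0 ≤ mutualInfo p s := ENNReal.toReal_nonneg
  have h6 : Real.log (c / v) = Real.log c + Real.log (1 / v) := by
    rw [← Real.log_mul hc0.ne' (one_div_pos.mpr hv0).ne', mul_one_div]
  rw [h6] at h1
  rw [rsPotential] at h4
  linarith

/-- Below the threshold all optimizers are close to `(0, ∞)` when the noise is small. -/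
theorem eventually_isOptimizer_mem (hpos : ∀ᵐ x ∂ν, 0 ≤ x)
    (hint : Integrable (fun x : ℝ => x) ν)
    (htop : Tendsto (fun z => z * etaTransform ν z) atTop atTop)
    [IsProbabilityMeasure p] (hp : Integrable (fun x : ℝ => x) p) {d : ℝ} (hd : HasInformationDimension p d)
    (hdδ : d < 1 - ν.real {0}) {W : Set (ℝ × EReal)} (hW : W ∈ 𝓝 ((0 : ℝ), (⊤ : EReal))) :
    ∀ᶠ v in 𝓝[>] (0 : ℝ), ∀ E s : ℝ, IsOptimizer ν p v E s → (E, (s : EReal)) ∈ W := by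
  obtain ⟨U, hU, V, hV, hUV⟩ := mem_nhds_prod_iff.mp hW
  obtain ⟨ε, hε, hεU⟩ := Metric.mem_nhds_iff.mp hU
  obtain ⟨y, hy⟩ := EReal.mem_nhds_top_iff.mp hV
  have hlog2 : 0 < Real.log 2 := Real.log_pos one_lt_two
  -- The `+ 1` gives the strict inequality `y < s`; the bound `4 log 2 / ε` with `s E ≤ 2 log 2`
  -- gives `E ≤ ε / 2`.
  filter_upwards [eventually_le_of_isOptimizer hpos hint htop hp hd hdδ (y + 1),
    eventually_le_of_isOptimizer hpos hint htop hp hd hdδ (4 * Real.log 2 / ε),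
    self_mem_nhdsWithin] with v h1 h2 hv E s h
  refine hUV ⟨hεU ?_, hy ?_⟩
  · have h3 := h.mul_le hpos hint htop hv
    have h4 := (div_le_iff₀ hε).mp (h2 E s h)
    have hs : 0 < s := lt_of_lt_of_le (by positivity) (h2 E s h)
    rw [Metric.mem_ball, Real.dist_eq, sub_zero, abs_of_nonneg h.1.1]
    refine lt_of_mul_lt_mul_left (a := s) ?_ hs.le
    linarith
  · exact EReal.coe_lt_coe_iff.mpr (by linarith [h1 E s h])

/-- Above the threshold the signal-to-noise ratio of the optimizers is bounded. -/
theorem exists_forall_isOptimizer_le (hpos : ∀ᵐ x ∂ν, 0 ≤ x)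
    (hint : Integrable (fun x : ℝ => x) ν)
    (htop : Tendsto (fun z => z * etaTransform ν z) atTop atTop)
    [IsProbabilityMeasure p] (hp : Integrable (fun x : ℝ => x) p) {d : ℝ} (hd : HasInformationDimension p d)
    (hdδ : 1 - ν.real {0} < d) :
    ∃ K : ℝ, ∀ v E s : ℝ, 0 < v → IsOptimizer ν p v E s → s ≤ K := by
  obtain ⟨d₁, hδd₁, hd₁⟩ := exists_between hdδ
  have hlog : Tendsto (fun s : ℝ => (d₁ - (1 - ν.real {0})) * Real.log s) atTop atTop :=
    Real.tendsto_log_atTop.const_mul_atTop (sub_pos.mpr hδd₁)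
  obtain ⟨K, hK⟩ := eventually_atTop.mp
    (((tendsto_mutualInfo_div_log hp hd).eventually_const_lt
      (by linarith : d₁ / 2 < d / 2)).and ((eventually_gt_atTop 1).and
        (hlog.eventually_gt_atTop (2 * mutualInfo p 0 + 1))))
  refine ⟨K, fun v E s hv h => ?_⟩
  by_contra! hsK
  obtain ⟨h1, hs1, h2⟩ := hK s hsK.le
  have hs0 : 0 < s := one_pos.trans hs1
  replace h1 := (lt_div_iff₀ (Real.log_pos hs1)).mp h1
  -- The trial `E = 1 / s` makes the penalty the constant `1 / 2`, and the two integrals differ by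
  -- at most `(1 - ν{0}) log s`, so the noise variance disappears.
  have h3 : rsPotential ν p v (1 / s) s
      ≤ mutualInfo p 0 + 1 / 2 * ∫ z in (0 : ℝ)..(1 / v), rTransform ν (-z) :=
    h.rsPotential_le hpos hint htop hv le_rfl
      (fun E' hE' => rsPotential_le hpos hint htop hv hE' le_rfl)
      ⟨(one_div_pos.mpr hs0).le, (div_le_one hs0).mpr hs1.le⟩
  have h4 := integral_rTransform_sub_le_log hpos hint htop (a := 1 / s / v) (b := 1 / v)
    (by positivity)
    (div_le_div_of_nonneg_right ((div_le_one hs0).mpr hs1.le) hv.le)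
  have h5 : 1 / v / (1 / s / v) = s := by field_simp
  rw [h5] at h4
  rw [rsPotential, mul_one_div_cancel hs0.ne'] at h3
  linarith

end Optimizer

end CompressedSensing

theorem mainTheorem4
    {Ω Ω' : Type*} [MeasurableSpace Ω] [MeasurableSpace Ω']
    (P : MeasureTheory.Measure Ω) [MeasureTheory.IsProbabilityMeasure P]
    (P' : MeasureTheory.Measure Ω') [MeasureTheory.IsProbabilityMeasure P']
    -- the sensing matrices, in the large system limit
    (M N : ℕ → ℕ) (A : ∀ k, Ω → Matrix (Fin (M k)) (Fin (N k)) ℝ) (δ : ℝ)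
    (hδ : 0 < δ)
    (hMN : ∀ k, M k ≤ N k)
    (hN : Filter.Tendsto N Filter.atTop Filter.atTop)
    (hrate : Filter.Tendsto (fun k => (M k : ℝ) / (N k : ℝ)) Filter.atTop (nhds δ))
    (hA : ∀ k, CompressedSensing.IsRightOrthogonallyInvariant P (A k))
    -- the asymptotic eigenvalue distribution of `Aᵀ A` and its moments
    (ν : MeasureTheory.Measure ℝ) [MeasureTheory.IsProbabilityMeasure ν]
    (hν : CompressedSensing.IsAsymptoticEigenvalueDistribution P A ν)
    (μ : ℕ → ℝ) (hμ : CompressedSensing.HasAsymptoticMoments P A μ)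
    (hμ1 : 0 < μ 1) (hμ2 : μ 1 ^ 2 < μ 2)
    -- the normalized rank tends to `δ`, and no positive fraction of the nonzero eigenvalues
    -- collapses to zero
    (hrank : ∀ᵐ ω ∂P, Filter.Tendsto (fun k => ((A k ω).rank : ℝ) / (N k : ℝ))
      Filter.atTop (nhds δ))
    (hzero : ν.real {0} = 1 - δ)
    -- `δ < 1`, or `δ = 1` and the asymptotic mean inverse eigenvalue diverges
    (hdiv : δ < 1 ∨ (δ = 1 ∧ ∫⁻ x, (ENNReal.ofReal x)⁻¹ ∂ν = ⊤))
    -- the signal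
    (x₁ : Ω' → ℝ) (hx : AEMeasurable x₁ P') (hx2 : ∫ ω, x₁ ω ^ 2 ∂P' = 1)
    (d : ℝ) (hd : CompressedSensing.HasInformationDimension (P'.map x₁) d) :
    -- optimizers exist for every noise variance
    (∀ v : ℝ, 0 < v → ∃ E s : ℝ, CompressedSensing.IsOptimizer ν (P'.map x₁) v E s) ∧
    -- the optimizer is noise-limited if and only if `δ > d`
    (δ ≠ d → ∀ Eopt sopt : ℝ → ℝ,
      (∀ v : ℝ, 0 < v → CompressedSensing.IsOptimizer ν (P'.map x₁) v (Eopt v) (sopt v)) →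
      ((Filter.Tendsto Eopt (nhdsWithin 0 (Set.Ioi 0)) (nhds 0) ∧
        Filter.Tendsto sopt (nhdsWithin 0 (Set.Ioi 0)) Filter.atTop) ↔ d < δ)) ∧
    -- if `δ > d`, the optimizer is unique in the limit of vanishing noise
    (d < δ → ∀ q : ℝ × EReal,
      CompressedSensing.IsLimitOptimizer ν (P'.map x₁) q ↔ q = (0, ⊤)) := by
  have hpos := hν.ae_nonneg
  have hint := hν.integrable_id hμ
  have htop : Filter.Tendsto (fun z => z * CompressedSensing.etaTransform ν z)
      Filter.atTop Filter.atTop := by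
    rcases hdiv with h | ⟨h, h'⟩
    · exact CompressedSensing.tendsto_mul_etaTransform_of_pos hpos (by linarith)
    · exact CompressedSensing.tendsto_mul_etaTransform_of_lintegral_inv hpos (by linarith) h'
  have hδν : δ = 1 - ν.real {0} := by linarith
  have := Measure.isProbabilityMeasure_map hx
  have hp : Integrable (fun x : ℝ => x) (P'.map x₁) := by
    refine (integrable_map_measure (by fun_prop) hx).mpr ?_
    -- A non-integrable function would have Bochner integral zero, not one.
    have h2 : Integrable (fun ω => x₁ ω ^ 2) P' := by
      by_contra h
      rw [integral_undef h] at hx2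
      exact zero_ne_one hx2
    refine (h2.add (integrable_const 1)).mono' hx.aestronglyMeasurable (ae_of_all _ fun ω => ?_)
    simp only [Function.comp, Pi.add_apply, Real.norm_eq_abs]
    nlinarith [sq_nonneg (|x₁ ω| - 1), sq_abs (x₁ ω)]
  have hexists : ∀ v : ℝ, 0 < v →
      ∃ E s : ℝ, CompressedSensing.IsOptimizer ν (P'.map x₁) v E s :=
    fun v hv => CompressedSensing.exists_isOptimizer hpos hint htop hp hv
  have hmem : d < δ → ∀ W ∈ nhds ((0 : ℝ), (⊤ : EReal)), ∀ᶠ v in nhdsWithin 0 (Set.Ioi 0),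
      ∀ E s : ℝ, CompressedSensing.IsOptimizer ν (P'.map x₁) v E s → (E, (s : EReal)) ∈ W :=
    fun hdδ W hW =>
      CompressedSensing.eventually_isOptimizer_mem hpos hint htop hp hd (hδν ▸ hdδ) hW
  refine ⟨hexists, fun hne Eopt sopt hopt => ⟨fun ⟨_, hs⟩ => ?_, fun hdδ => ?_⟩, fun hdδ q => ?_⟩
  · by_contra! hle
    obtain ⟨K, hK⟩ := CompressedSensing.exists_forall_isOptimizer_le hpos hint htop hp hd
      (hδν ▸ lt_of_le_of_ne hle hne)
    obtain ⟨v, hv, hv0⟩ := ((hs.eventually_gt_atTop K).and self_mem_nhdsWithin).exists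
    exact absurd (hK v _ _ hv0 (hopt v hv0)) (not_le.mpr hv)
  · have h : Filter.Tendsto (fun v => (Eopt v, (sopt v : EReal))) (nhdsWithin 0 (Set.Ioi 0))
        (nhds (0, ⊤)) := by
      refine Filter.tendsto_def.mpr fun W hW => ?_
      filter_upwards [hmem hdδ W hW, self_mem_nhdsWithin] with v h hv
      exact h _ _ (hopt v hv)
    exact ⟨(continuous_fst.tendsto _).comp h,
      EReal.tendsto_coe_nhds_top_iff.mp ((continuous_snd.tendsto _).comp h)⟩
  · constructor
    · intro hq
      by_contra hne
      -- Optimizers near `q` occur at arbitrarily small noise, yet eventually all lie near `(0, ⊤)`;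
      -- disjoint neighbourhoods contradict this.
      obtain ⟨W, W', hW, hW', hdisj⟩ := t2_separation_nhds hne
      obtain ⟨v, ⟨E, s, h, hWm⟩, hv⟩ := ((hq W hW).and_eventually (hmem hdδ W' hW')).exists
      exact Set.disjoint_left.mp hdisj hWm (hv E s h)
    · rintro rfl W hW
      refine Filter.Eventually.frequently ?_
      filter_upwards [hmem hdδ W hW, self_mem_nhdsWithin] with v h hv
      obtain ⟨E, s, hopt⟩ := hexists v hv
      exact ⟨E, s, hopt, h E s hopt⟩
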